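/- Let $0<q<p<1$ be fixed. For even $n\ge 2$ let $G(n,p,q)$ be the random graph on the vertex set $\{1,\dots,n\}$, whose two clusters are the first $n/2$ and the last $n/2$ vertices, in which every pair of distinct vertices is joined independently, with probability $p$ if both lie in the same cluster and with probability $q$ otherwise. For a vertex $i$ write $$d_i=\#\{\text{neighbors of } i \text{ in its own cluster}\}-\#\{\text{neighbors of } i \text{ in the other cluster}\},$$ and let $\mathbf{v_2}$ be an eigenvector of the adjacency matrix for its second largest eigenvalue (counted with multiplicity). Then for every $\eta>0$ there is $\varepsilon\in(0,1)$ (depending on $p,q,\eta$) such that with high probability, that is, with probability at least $1-Ce^{-cn}$ for constants $C,c>0$ independent of $n$, the following holds for every such $\mathbf{v_2}$: at least $99\%$ of the vertices carrying the $\lfloor\varepsilon n\rfloor$ largest entries of $\mathbf{v_2}$ satisfy $$d_i-\frac{(p-q)n}{2}\ \ge\ \eta\sqrt n ,$$ and likewise at least $99\%$ of the vertices carrying the $\lfloor\varepsilon n\rfloor$ smallest entries of $\mathbf{v_2}$ satisfy this inequality (however ties among the entries are broken). -/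

import Mathlib

open MeasureTheory

noncomputable section

namespace StochasticBlock

/-- Two vertices lie in the same cluster: the clusters are the first `n / 2` vertices and the
remaining ones (`n` is even wherever this is used). -/
def SameCluster {n : ℕ} (i j : Fin n) : Prop :=
  (i : ℕ) < n / 2 ↔ (j : ℕ) < n / 2

/-- The unordered pairs of different vertices, each written with its smaller vertex first. -/
abbrev VertexPair (n : ℕ) : Type := {e : Fin n × Fin n // e.1 < e.2}

/-- The graph whose edges are the pairs that `ω` marks by `true`. -/
def graphOf {n : ℕ} (ω : VertexPair n → Bool) : SimpleGraph (Fin n) where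
  Adj i j := (∃ h : i < j, ω ⟨(i, j), h⟩ = true) ∨ (∃ h : j < i, ω ⟨(j, i), h⟩ = true)
  symm := ⟨fun _ _ h => h.symm⟩
  loopless := ⟨fun _ h => by
    rcases h with ⟨h, _⟩ | ⟨h, _⟩ <;> exact lt_irrefl _ h⟩

open Classical in
/-- The probability that a given pair is an edge: `p` within a cluster, `q` across. -/
def edgeProb {n : ℕ} (p q : ℝ) (e : VertexPair n) : ℝ :=
  if SameCluster e.1.1 e.1.2 then p else q

/-- The law of the edge indicators: independent Bernoulli variables. -/
def edgeLaw (n : ℕ) (p q : ℝ) : Measure (VertexPair n → Bool) :=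
  Measure.pi fun e =>
    ENNReal.ofReal (edgeProb p q e) • Measure.dirac true +
      ENNReal.ofReal (1 - edgeProb p q e) • Measure.dirac false

/-- The stochastic block model `G(n, p, q)`, as a measure on graphs with vertex set `Fin n`. -/
def sbm (n : ℕ) (p q : ℝ) : Measure (SimpleGraph (Fin n)) :=
  (edgeLaw n p q).map graphOf

theorem measurable_graphOf (n : ℕ) : Measurable (graphOf (n := n)) :=
  Measurable.of_discrete

/-- For parameters in `[0, 1]` the model is a probability measure. -/
theorem isProbabilityMeasure_sbm (n : ℕ) {p q : ℝ} (hp : p ∈ Set.Icc (0 : ℝ) 1)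
    (hq : q ∈ Set.Icc (0 : ℝ) 1) : IsProbabilityMeasure (sbm n p q) := by
  have h : ∀ e : VertexPair n, IsProbabilityMeasure
      (ENNReal.ofReal (edgeProb p q e) • Measure.dirac true +
        ENNReal.ofReal (1 - edgeProb p q e) • Measure.dirac false : Measure Bool) := by
    intro e
    have : edgeProb p q e ∈ Set.Icc (0 : ℝ) 1 := by
      unfold edgeProb
      split_ifs <;> assumption
    constructor
    simp [← ENNReal.ofReal_add this.1 (sub_nonneg.2 this.2)]
  have : IsProbabilityMeasure (edgeLaw n p q) := by
    unfold edgeLaw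
    infer_instance
  exact Measure.isProbabilityMeasure_map (measurable_graphOf n).aemeasurable

open Classical in
/-- `v` is an eigenvector of the adjacency matrix of `G` for its second largest eigenvalue
(eigenvalues are listed in decreasing order with multiplicity, so index `1` is the second). -/
def IsSecondEigenvector {n : ℕ} (G : SimpleGraph (Fin n)) (v : Fin n → ℝ) : Prop :=
  v ≠ 0 ∧ ∃ (hA : (G.adjMatrix ℝ).IsHermitian) (h : 1 < Fintype.card (Fin n)),
    Matrix.mulVec (G.adjMatrix ℝ) v = hA.eigenvalues₀ ⟨1, h⟩ • v

open Classical in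
/-- The number of in-cluster neighbors of `i` minus its number of out-cluster neighbors. -/
def attachment {n : ℕ} (G : SimpleGraph (Fin n)) (i : Fin n) : ℝ :=
  ((Finset.univ.filter fun j => G.Adj i j ∧ SameCluster i j).card : ℝ) -
    ((Finset.univ.filter fun j => G.Adj i j ∧ ¬ SameCluster i j).card : ℝ)

/-- `S` consists of `k` vertices carrying the `k` largest entries of `v` (ties are broken
arbitrarily, so there may be several such sets). -/
def IsTopSet {n : ℕ} (v : Fin n → ℝ) (k : ℕ) (S : Finset (Fin n)) : Prop :=
  S.card = k ∧ ∀ i ∈ S, ∀ j ∉ S, v j ≤ v i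

/-- `S` consists of `k` vertices carrying the `k` smallest entries of `v`. -/
def IsBottomSet {n : ℕ} (v : Fin n → ℝ) (k : ℕ) (S : Finset (Fin n)) : Prop :=
  S.card = k ∧ ∀ i ∈ S, ∀ j ∉ S, v i ≤ v j

open Classical in
/-- At least `99%` of the vertices in `S` have an attachment that exceeds its typical value
`(p - q) n / 2` by at least `η √n`. -/
def MostlyAttached {n : ℕ} (p q η : ℝ) (G : SimpleGraph (Fin n)) (S : Finset (Fin n)) : Prop :=
  (99 / 100 : ℝ) * (S.card : ℝ) ≤
    ((S.filter fun i =>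
      (p - q) * (n : ℝ) / 2 + η * Real.sqrt (n : ℝ) ≤ attachment G i).card : ℝ)

/-- For every second eigenvector, both the vertices with the `ε n` largest entries and those with
the `ε n` smallest entries are mostly attached. -/
def ExtremesAttached {n : ℕ} (p q η ε : ℝ) (G : SimpleGraph (Fin n)) : Prop :=
  ∀ v : Fin n → ℝ, IsSecondEigenvector G v → ∀ S : Finset (Fin n),
    (IsTopSet v ⌊ε * (n : ℝ)⌋₊ S ∨ IsBottomSet v ⌊ε * (n : ℝ)⌋₊ S) →
      MostlyAttached p q η G S

end StochasticBlock

end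

/-! Let σ be the vector of cluster signs. The adjacency matrix is A = (p+q)/2 · 11ᵀ + (p-q)/2 · σσᵀ
- pI + W with centered noise W, and an ε-net argument gives ‖W‖ ≤ 12√n outside an event of
probability e^{-n} (`measureReal_not_normBound_le`). By Courant–Fischer, the second eigenvalue μ
satisfies μ + p = (p-q)n/2 + O(√n).

Decompose a second eigenvector orthogonally as v = a1 + bσ + u and put w = a1 + u. Since μ is at
distance of order n from both (p+q)n/2 - p and -p, one gets |w| = O(n^{-1/2})|v|. Hence (μ+p)v = α1
+ b(Aσ + pσ + ρ) with ρ = Ww/b and |ρ|² = O(n) (`eigenvector_expansion`). As (Aσ)_i = σ_i d_i, the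
entries of v are, up to an affine map, σ_i(d_i + p) + ρ_i, and all but O(1) of the ρ_i are below √n,
the scale that matters. So, up to O(1) exceptions, an extreme set lies in one cluster and has d_i at
least as large, up to O(√n), as any chosen nonexceptional vertex of that cluster outside the set
(`mostlyAttached_of_normBound`).

It remains to find in each cluster more than εn + O(1) vertices whose d_j exceeds (p-q)n/2 by
(η+3)√n (`measureReal_few_attached_le`). The noise of d_j splits into an inner and a cross part. The
norm bound keeps the inner part above -24√n for three quarters of the cluster. The cross parts of
the vertices of one cluster use disjoint sets of pairs, so they are independent of each other and of
all inner edges; by the central limit theorem each is as large as needed with probability at least a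
fixed κ > 0. Conditioning on the inner edges and applying Hoeffding's inequality gives a linear
number of such vertices, and ε = κ/16 suffices. -/

noncomputable section

namespace StochasticBlock

open ProbabilityTheory Filter

/-! ### Courant–Fischer bounds for the second eigenvalue. -/

section Eigenvalues

theorem dotProduct_mulVec_comm_of_isHermitian {ι : Type*} [Fintype ι] {A : Matrix ι ι ℝ}
    (hA : A.IsHermitian) (x y : ι → ℝ) :
    x ⬝ᵥ A.mulVec y = A.mulVec x ⬝ᵥ y := by
  rw [Matrix.dotProduct_mulVec]
  congr 1
  have : A.transpose = A := by rw [← Matrix.conjTranspose_eq_transpose_of_trivial]; exact hA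
  conv_lhs => rw [← this, Matrix.vecMul_transpose]

variable {ι : Type*} [Fintype ι] [DecidableEq ι] {A : Matrix ι ι ℝ}

/-- Indexing by position keeps the decreasing order of `eigenvalues₀`, so that indices 0 and 1 are
the top two; the last clause is Parseval's identity. -/
theorem exists_sorted_eigenbasis (hA : A.IsHermitian) :
    ∃ b : Fin (Fintype.card ι) → ι → ℝ,
      (∀ k, A.mulVec (b k) = hA.eigenvalues₀ k • b k) ∧
      (∀ k l, b k ⬝ᵥ b l = if k = l then 1 else 0) ∧
      ∀ x y : ι → ℝ, x ⬝ᵥ y = ∑ k, (b k ⬝ᵥ x) * (b k ⬝ᵥ y) := by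
  set e : Fin (Fintype.card ι) ≃ ι := Fintype.equivOfCardEq (Fintype.card_fin _) with he
  have hdot : ∀ x y : EuclideanSpace ℝ ι, inner ℝ x y = x.ofLp ⬝ᵥ y.ofLp := by
    intro x y
    rw [EuclideanSpace.inner_eq_star_dotProduct, dotProduct_comm]
    simp
  refine ⟨fun k => (hA.eigenvectorBasis (e k)).ofLp, fun k => ?_, fun k l => ?_, fun x y => ?_⟩
  · rw [hA.mulVec_eigenvectorBasis]
    simp [Matrix.IsHermitian.eigenvalues, he]
  · rw [← hdot, orthonormal_iff_ite.1 hA.eigenvectorBasis.orthonormal]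
    simp
  · have := hA.eigenvectorBasis.sum_inner_mul_inner (WithLp.toLp 2 x) (WithLp.toLp 2 y)
    rw [hdot] at this
    rw [← this, ← e.sum_comp]
    refine Finset.sum_congr rfl fun k _ => ?_
    rw [hdot, hdot, dotProduct_comm x]

/-- The span of the first two eigenvectors contains a nonzero vector orthogonal to `f`, and on this
span the quadratic form is at least the second eigenvalue times the squared norm. -/
theorem second_eigenvalue_le (hA : A.IsHermitian) (h : 1 < Fintype.card ι) (f : ι → ℝ) {c : ℝ}
    (hc : ∀ z : ι → ℝ, z ⬝ᵥ f = 0 → z ⬝ᵥ A.mulVec z ≤ c * (z ⬝ᵥ z)) :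
    hA.eigenvalues₀ ⟨1, h⟩ ≤ c := by
  obtain ⟨b, hb, ho, -⟩ := exists_sorted_eigenbasis hA
  set k0 : Fin (Fintype.card ι) := ⟨0, by omega⟩
  set k1 : Fin (Fintype.card ι) := ⟨1, h⟩
  have hk : k0 ≠ k1 := by simp [k0, k1]
  have hle : hA.eigenvalues₀ k1 ≤ hA.eigenvalues₀ k0 := hA.eigenvalues₀_antitone (by simp [k0, k1])
  have key : ∀ α β : ℝ, 0 < α ^ 2 + β ^ 2 → α * (b k0 ⬝ᵥ f) + β * (b k1 ⬝ᵥ f) = 0 →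
      hA.eigenvalues₀ k1 ≤ c := by
    intro α β hpos h0
    have := hc (α • b k0 + β • b k1) (by simpa [add_dotProduct] using h0)
    simp only [Matrix.mulVec_add, Matrix.mulVec_smul, hb, add_dotProduct, dotProduct_add,
      smul_dotProduct, dotProduct_smul, ho, hk, hk.symm, smul_eq_mul, if_true, if_false] at this
    have h2 : hA.eigenvalues₀ k1 * (α ^ 2 + β ^ 2) ≤ c * (α ^ 2 + β ^ 2) := by
      nlinarith [mul_nonneg (sub_nonneg.2 hle) (sq_nonneg α)]
    exact le_of_mul_le_mul_right h2 hpos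
  by_cases h1 : b k0 ⬝ᵥ f = 0 ∧ b k1 ⬝ᵥ f = 0
  · exact key 1 1 (by norm_num) (by simp [h1.1, h1.2])
  · refine key (b k1 ⬝ᵥ f) (-(b k0 ⬝ᵥ f)) ?_ (by ring)
    by_contra hn
    exact h1 ⟨by nlinarith [sq_nonneg (b k0 ⬝ᵥ f), sq_nonneg (b k1 ⬝ᵥ f)],
      by nlinarith [sq_nonneg (b k0 ⬝ᵥ f), sq_nonneg (b k1 ⬝ᵥ f)]⟩

/-- The plane spanned by `x` and `y` contains a nonzero vector orthogonal to the top eigenvector,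
and there the quadratic form is at most the second eigenvalue times the squared norm. -/
theorem le_second_eigenvalue (hA : A.IsHermitian) (h : 1 < Fintype.card ι) (x y : ι → ℝ)
    (hxy : LinearIndependent ℝ ![x, y]) {c : ℝ}
    (hc : ∀ α β : ℝ, c * ((α • x + β • y) ⬝ᵥ (α • x + β • y)) ≤
      (α • x + β • y) ⬝ᵥ A.mulVec (α • x + β • y)) :
    c ≤ hA.eigenvalues₀ ⟨1, h⟩ := by
  obtain ⟨b, hb, -, hs⟩ := exists_sorted_eigenbasis hA
  set k0 : Fin (Fintype.card ι) := ⟨0, by omega⟩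
  set k1 : Fin (Fintype.card ι) := ⟨1, h⟩
  have key : ∀ α β : ℝ, (α ≠ 0 ∨ β ≠ 0) → b k0 ⬝ᵥ (α • x + β • y) = 0 →
      c ≤ hA.eigenvalues₀ k1 := by
    intro α β hne h0
    have h1 := hc α β
    set z := α • x + β • y with hz
    have hz0 : z ≠ 0 := by
      intro h
      have := LinearIndependent.pair_iff.1 hxy α β (by rw [← hz, h])
      tauto
    have hpos : 0 < z ⬝ᵥ z := by
      have := Matrix.dotProduct_star_self_pos_iff (v := z)
      simpa using this.2 hz0
    have h2 : z ⬝ᵥ A.mulVec z ≤ hA.eigenvalues₀ k1 * (z ⬝ᵥ z) := by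
      rw [hs z z, hs z (A.mulVec z), Finset.mul_sum]
      refine Finset.sum_le_sum fun k _ => ?_
      rw [dotProduct_mulVec_comm_of_isHermitian hA, hb, smul_dotProduct, smul_eq_mul]
      by_cases hk : k = k0
      · rw [hk, h0]; simp
      · have : hA.eigenvalues₀ k ≤ hA.eigenvalues₀ k1 := by
          apply hA.eigenvalues₀_antitone
          have : (k : ℕ) ≠ 0 := fun h => hk (Fin.ext h)
          exact Fin.mk_le_of_le_val (by omega)
        nlinarith [mul_nonneg (sub_nonneg.2 this) (sq_nonneg (b k ⬝ᵥ z))]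
    exact le_of_mul_le_mul_right (h1.trans h2) hpos
  by_cases h1 : b k0 ⬝ᵥ x = 0 ∧ b k0 ⬝ᵥ y = 0
  · exact key 1 1 (by norm_num) (by simp [dotProduct_add, h1.1, h1.2])
  · refine key (b k0 ⬝ᵥ y) (-(b k0 ⬝ᵥ x)) ?_ ?_
    · rw [neg_ne_zero]; tauto
    · simp only [dotProduct_add, dotProduct_smul, smul_eq_mul]; ring

end Eigenvalues

/-! ### Perturbation of the second eigenvector by noise of bounded norm. -/

section Perturbation

theorem sq_dotProduct_le {ι : Type*} [Fintype ι] (x y : ι → ℝ) :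
    (x ⬝ᵥ y) ^ 2 ≤ (x ⬝ᵥ x) * (y ⬝ᵥ y) := by
  have := Finset.sum_mul_sq_le_sq_mul_sq Finset.univ x y
  simpa [dotProduct, pow_two] using this

theorem dotProduct_self_nonneg_real {ι : Type*} [Fintype ι] (x : ι → ℝ) : 0 ≤ x ⬝ᵥ x :=
  Finset.sum_nonneg fun i _ => mul_self_nonneg (x i)

/-- Chebyshev's inequality for counting measure; it turns every Euclidean bound below into a bound
on the number of exceptional vertices. -/
theorem card_filter_abs_ge_mul_sq_le {ι : Type*} [Fintype ι] (r : ι → ℝ) {t : ℝ} (ht : 0 ≤ t)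
    (S : Finset ι) (hS : ∀ i ∈ S, t ≤ |r i|) : (S.card : ℝ) * t ^ 2 ≤ r ⬝ᵥ r := by
  calc (S.card : ℝ) * t ^ 2 = ∑ _i ∈ S, t ^ 2 := by simp
    _ ≤ ∑ i ∈ S, r i * r i := Finset.sum_le_sum fun i hi => by
        rw [← pow_two, ← sq_abs (r i)]; exact pow_le_pow_left₀ ht (hS i hi) 2
    _ ≤ r ⬝ᵥ r := Finset.sum_le_sum_of_subset_of_nonneg (Finset.subset_univ _)
        fun i _ _ => mul_self_nonneg (r i)

/-- The matrix `A` is a noisy two-cluster matrix: outside of the multiple of the identity that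
removes the diagonal, it is `W` plus the expected adjacency matrix for the signs `σ`. -/
structure IsNoisyBlock {ι : Type*} [Fintype ι] [DecidableEq ι] (p q : ℝ) (σ : ι → ℝ)
    (A W : Matrix ι ι ℝ) : Prop where
  sign : ∀ i, σ i = 1 ∨ σ i = -1
  balanced : ∑ i, σ i = 0
  apply_eq : ∀ i j, A i j =
    (p + q) / 2 + (p - q) / 2 * (σ i * σ j) - (if i = j then p else 0) + W i j

/-- The Euclidean operator norm of `W` is at most `K`. -/
def NormBound {ι : Type*} [Fintype ι] (W : Matrix ι ι ℝ) (K : ℝ) : Prop :=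
  0 ≤ K ∧ ∀ x : ι → ℝ, W.mulVec x ⬝ᵥ W.mulVec x ≤ K ^ 2 * (x ⬝ᵥ x)

theorem NormBound.abs_dotProduct_le {ι : Type*} [Fintype ι] {W : Matrix ι ι ℝ} {K : ℝ}
    (hW : NormBound W K) (z : ι → ℝ) : |z ⬝ᵥ W.mulVec z| ≤ K * (z ⬝ᵥ z) := by
  have hz := dotProduct_self_nonneg_real z
  apply abs_le_of_sq_le_sq _ (mul_nonneg hW.1 hz)
  calc (z ⬝ᵥ W.mulVec z) ^ 2 ≤ (z ⬝ᵥ z) * (W.mulVec z ⬝ᵥ W.mulVec z) := sq_dotProduct_le _ _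
    _ ≤ (z ⬝ᵥ z) * (K ^ 2 * (z ⬝ᵥ z)) := mul_le_mul_of_nonneg_left (hW.2 z) hz
    _ = _ := by ring

namespace IsNoisyBlock

variable {ι : Type*} [Fintype ι] [DecidableEq ι] {p q K : ℝ} {σ : ι → ℝ} {A W : Matrix ι ι ℝ}

theorem sign_mul_self (h : IsNoisyBlock p q σ A W) (i : ι) : σ i * σ i = 1 := by
  rcases h.sign i with h | h <;> rw [h] <;> norm_num

theorem sign_dot_self (h : IsNoisyBlock p q σ A W) : σ ⬝ᵥ σ = Fintype.card ι := by
  simp [dotProduct, h.sign_mul_self]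

theorem one_dot_sign (h : IsNoisyBlock p q σ A W) : (1 : ι → ℝ) ⬝ᵥ σ = 0 := by
  simp [dotProduct, h.balanced]

theorem sign_dot_one (h : IsNoisyBlock p q σ A W) : σ ⬝ᵥ (1 : ι → ℝ) = 0 := by
  simp [dotProduct, h.balanced]

theorem mulVec_eq (h : IsNoisyBlock p q σ A W) (x : ι → ℝ) :
    A.mulVec x = ((p + q) / 2 * ((1 : ι → ℝ) ⬝ᵥ x)) • (1 : ι → ℝ) +
      ((p - q) / 2 * (σ ⬝ᵥ x)) • σ - p • x + W.mulVec x := by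
  ext i
  simp only [Matrix.mulVec, dotProduct, h.apply_eq, Pi.add_apply, Pi.sub_apply, Pi.smul_apply,
    smul_eq_mul, add_mul, sub_mul, Finset.sum_add_distrib, Finset.sum_sub_distrib, Pi.one_apply,
    ite_mul, zero_mul, Finset.sum_ite_eq, Finset.mem_univ, if_true, Finset.mul_sum, one_mul,
    Finset.sum_mul, mul_one]
  congr 3
  exact Finset.sum_congr rfl fun j _ => by ring

theorem linearIndependent (h : IsNoisyBlock p q σ A W) (hι : 0 < Fintype.card ι) :
    LinearIndependent ℝ ![(1 : ι → ℝ), σ] := by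
  have hc : (0 : ℝ) < Fintype.card ι := by exact_mod_cast hι
  rw [LinearIndependent.pair_iff]
  intro s t hst
  have h1 : (1 : ι → ℝ) ⬝ᵥ (s • (1 : ι → ℝ) + t • σ) = 0 := by rw [hst, dotProduct_zero]
  have h2 : σ ⬝ᵥ (s • (1 : ι → ℝ) + t • σ) = 0 := by rw [hst, dotProduct_zero]
  simp only [dotProduct_add, dotProduct_smul, h.one_dot_sign, h.sign_dot_one, h.sign_dot_self,
    one_dotProduct_one, smul_eq_mul, mul_zero, add_zero, zero_add, mul_eq_zero] at h1 h2
  exact ⟨h1.resolve_right hc.ne', h2.resolve_right hc.ne'⟩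

/-- Lower bound: test on the span of 1 and σ, where the form without noise has eigenvalues (p±q)n/2
- p. Upper bound: on the complement of 1 only the σσᵀ term is left, and Cauchy–Schwarz bounds it. -/
theorem abs_second_eigenvalue_sub_le (h : IsNoisyBlock p q σ A W) (hW : NormBound W K)
    (hA : A.IsHermitian) (hι : 1 < Fintype.card ι) (hq : 0 ≤ q) (hpq : q ≤ p) :
    |hA.eigenvalues₀ ⟨1, hι⟩ + p - (p - q) / 2 * Fintype.card ι| ≤ K := by
  have hn : (0 : ℝ) ≤ Fintype.card ι := by positivity
  rw [abs_le]
  constructor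
  · have := le_second_eigenvalue hA hι 1 σ (h.linearIndependent (by omega))
      (c := (p - q) / 2 * Fintype.card ι - p - K) fun α β => by
        set z := α • (1 : ι → ℝ) + β • σ with hz
        have h1 : (1 : ι → ℝ) ⬝ᵥ z = α * Fintype.card ι := by
          simp only [hz, dotProduct_add, dotProduct_smul, h.one_dot_sign, one_dotProduct_one,
            smul_eq_mul, mul_zero, add_zero]
        have h2 : σ ⬝ᵥ z = β * Fintype.card ι := by
          simp only [hz, dotProduct_add, dotProduct_smul, h.sign_dot_one, h.sign_dot_self,
            smul_eq_mul, mul_zero, zero_add]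
        have h3 : z ⬝ᵥ z = (α ^ 2 + β ^ 2) * Fintype.card ι := by
          conv_lhs => rw [hz, add_dotProduct, smul_dotProduct, smul_dotProduct, ← hz, h1, h2]
          simp only [smul_eq_mul]; ring
        have h4 := (abs_le.1 (hW.abs_dotProduct_le z)).1
        clear_value z
        rw [h.mulVec_eq, dotProduct_add, dotProduct_sub, dotProduct_add, dotProduct_smul,
          dotProduct_smul, dotProduct_smul, dotProduct_comm z 1, dotProduct_comm z σ, h1, h2]
        simp only [smul_eq_mul]
        have h5 : 0 ≤ q * (α * Fintype.card ι) ^ 2 := by positivity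
        have h6 : (p - q) / 2 * Fintype.card ι * (z ⬝ᵥ z) =
            (p - q) / 2 * (α * Fintype.card ι) ^ 2 + (p - q) / 2 * (β * Fintype.card ι) ^ 2 := by
          rw [h3]; ring
        linarith
    linarith
  · have := second_eigenvalue_le hA hι 1 (c := (p - q) / 2 * Fintype.card ι - p + K) fun z hz => by
        have h4 := (abs_le.1 (hW.abs_dotProduct_le z)).2
        have h5 := sq_dotProduct_le σ z
        rw [h.sign_dot_self] at h5
        rw [h.mulVec_eq, dotProduct_add, dotProduct_sub, dotProduct_add, dotProduct_smul,
          dotProduct_smul, dotProduct_smul, dotProduct_comm z σ, hz]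
        simp only [smul_eq_mul]
        nlinarith [mul_le_mul_of_nonneg_left h5 (by linarith : 0 ≤ (p - q) / 2)]
    linarith

/-- Up to scaling and shifting, an eigenvector for the second eigenvalue is close to the image of
the sign vector under the matrix, with an error much smaller than the typical fluctuations. -/
theorem eigenvector_expansion (h : IsNoisyBlock p q σ A W) (hW : NormBound W K)
    (hq : 0 < q) (hpq : q < p) {μ : ℝ} {v : ι → ℝ} (hv : v ≠ 0) (hAv : A.mulVec v = μ • v)
    (hμ : |μ + p - (p - q) / 2 * Fintype.card ι| ≤ K)
    (hK1 : K ≤ (p - q) / 4 * Fintype.card ι) (hK2 : K ≤ q / 2 * Fintype.card ι)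
    (hK3 : 8 * K ^ 2 * (1 / q ^ 2 + 1 / ((p - q) / 2) ^ 2) ≤ (Fintype.card ι : ℝ) ^ 2) :
    0 < μ + p ∧ ∃ b α : ℝ, ∃ ρ : ι → ℝ, b ≠ 0 ∧
      ρ ⬝ᵥ ρ * Fintype.card ι ≤ 8 * K ^ 4 * (1 / q ^ 2 + 1 / ((p - q) / 2) ^ 2) ∧
      ∀ i, (μ + p) * v i = α + b * (A.mulVec σ i + p * σ i + ρ i) := by
  have hcard : 0 < Fintype.card ι := by
    obtain ⟨i, -⟩ := Function.ne_iff.1 hv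
    exact Fintype.card_pos_iff.2 ⟨i⟩
  set n : ℝ := (Fintype.card ι : ℝ) with hn
  have hn0 : 0 < n := by rw [hn]; exact_mod_cast hcard
  set θ : ℝ := (p - q) / 2 with hθ
  have hθ0 : 0 < θ := by rw [hθ]; linarith
  obtain ⟨hμ1, hμ2⟩ := abs_le.1 hμ
  have hlow : θ * n / 2 ≤ μ + p := by nlinarith
  have hlow0 : 0 < θ * n / 2 := by positivity
  refine ⟨by linarith, ?_⟩
  have hhigh : q * n / 2 ≤ (p + q) / 2 * n - (μ + p) := by
    have : (p + q) / 2 * n = θ * n + q * n := by rw [hθ]; ring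
    nlinarith
  set V := v ⬝ᵥ v with hV
  have hV0 : 0 < V := by
    have := Matrix.dotProduct_star_self_pos_iff (v := v)
    simpa using this.2 hv
  set a := ((1 : ι → ℝ) ⬝ᵥ v) / n with ha
  set b := (σ ⬝ᵥ v) / n with hb
  have ha' : (1 : ι → ℝ) ⬝ᵥ v = a * n := by rw [ha]; field_simp
  have hb' : σ ⬝ᵥ v = b * n := by rw [hb]; field_simp
  set u := v - a • (1 : ι → ℝ) - b • σ with hu
  have hone : (1 : ι → ℝ) ⬝ᵥ 1 = n := by rw [one_dotProduct_one]
  have hu1 : u ⬝ᵥ (1 : ι → ℝ) = 0 := by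
    rw [hu, sub_dotProduct, sub_dotProduct, smul_dotProduct, smul_dotProduct, h.sign_dot_one, hone,
      dotProduct_comm, ha']
    simp
  have huσ : u ⬝ᵥ σ = 0 := by
    rw [hu, sub_dotProduct, sub_dotProduct, smul_dotProduct, smul_dotProduct, h.one_dot_sign,
      h.sign_dot_self, dotProduct_comm, hb']
    simp [hn]
  have hvdec : v = a • (1 : ι → ℝ) + b • σ + u := by rw [hu]; abel
  have huv : u ⬝ᵥ v = u ⬝ᵥ u := by
    conv_lhs => rw [hvdec]
    simp [dotProduct_add, hu1, huσ]
  have hVdec : V = n * a ^ 2 + n * b ^ 2 + u ⬝ᵥ u := by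
    rw [hV]
    conv_lhs => arg 1; rw [hvdec]
    rw [add_dotProduct, add_dotProduct, smul_dotProduct, smul_dotProduct, huv, ha', hb']
    simp only [smul_eq_mul]; ring
  have heq : (μ + p) • v = ((p + q) / 2 * (a * n)) • (1 : ι → ℝ) + (θ * (b * n)) • σ +
      W.mulVec v := by
    rw [add_smul, ← hAv, h.mulVec_eq, ha', hb']
    abel
  have hWv := hW.2 v
  have hu0 := dotProduct_self_nonneg_real u
  -- Pairing the eigenvalue equation with 1 leaves the gap (p+q)n/2 - (μ+p) ≥ qn/2 times the
  -- coefficient `a` against the noise.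
  have hab : n * a ^ 2 ≤ 4 * K ^ 2 / q ^ 2 * V / n ^ 2 := by
    have h1 : (1 : ι → ℝ) ⬝ᵥ ((μ + p) • v) = (1 : ι → ℝ) ⬝ᵥ (((p + q) / 2 * (a * n)) • (1 : ι → ℝ) +
      (θ * (b * n)) • σ + W.mulVec v) := by rw [heq]
    rw [dotProduct_add, dotProduct_add, dotProduct_smul, dotProduct_smul, dotProduct_smul,
      h.one_dot_sign, hone, ha'] at h1
    simp only [smul_eq_mul, mul_zero, add_zero] at h1
    have h2 : (1 : ι → ℝ) ⬝ᵥ W.mulVec v = -(((p + q) / 2 * n - (μ + p)) * (a * n)) := by linarith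
    have h3 := sq_dotProduct_le (1 : ι → ℝ) (W.mulVec v)
    rw [h2, hone] at h3
    have h4 : (q * n / 2) ^ 2 ≤ ((p + q) / 2 * n - (μ + p)) ^ 2 :=
      pow_le_pow_left₀ (by positivity) hhigh 2
    have h5 : (q * n / 2) ^ 2 * (a * n) ^ 2 ≤ n * (K ^ 2 * V) := by
      calc _ ≤ ((p + q) / 2 * n - (μ + p)) ^ 2 * (a * n) ^ 2 :=
            mul_le_mul_of_nonneg_right h4 (sq_nonneg _)
        _ = (-(((p + q) / 2 * n - (μ + p)) * (a * n))) ^ 2 := by ring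
        _ ≤ _ := h3.trans (mul_le_mul_of_nonneg_left hWv hn0.le)
    rw [le_div_iff₀ (by positivity), div_mul_eq_mul_div, le_div_iff₀ (by positivity)]
    have : n * a ^ 2 * n ^ 2 * q ^ 2 * n = 4 * ((q * n / 2) ^ 2 * (a * n) ^ 2) := by ring
    have h6 : n * a ^ 2 * n ^ 2 * q ^ 2 * n ≤ 4 * K ^ 2 * V * n := by rw [this]; linarith
    exact le_of_mul_le_mul_right h6 hn0
  -- Pairing with `u` removes both rank-one terms, leaving (μ+p)|u|² = ⟨u, Wv⟩ with μ+p ≥ θn/2.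
  have huu : u ⬝ᵥ u ≤ 4 * K ^ 2 / θ ^ 2 * V / n ^ 2 := by
    have h1 : u ⬝ᵥ ((μ + p) • v) = u ⬝ᵥ (((p + q) / 2 * (a * n)) • (1 : ι → ℝ) +
      (θ * (b * n)) • σ + W.mulVec v) := by rw [heq]
    rw [dotProduct_add, dotProduct_add, dotProduct_smul, dotProduct_smul, dotProduct_smul,
      hu1, huσ, huv] at h1
    simp only [smul_eq_mul, mul_zero, zero_add] at h1
    have h3 := sq_dotProduct_le u (W.mulVec v)
    rw [← h1] at h3
    rcases hu0.eq_or_lt with h0 | h0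
    · rw [← h0]; positivity
    have h4 : (θ * n / 2) ^ 2 ≤ (μ + p) ^ 2 := pow_le_pow_left₀ hlow0.le hlow 2
    have h5 : (θ * n / 2) ^ 2 * (u ⬝ᵥ u) * (u ⬝ᵥ u) ≤ (K ^ 2 * V) * (u ⬝ᵥ u) := by
      calc (θ * n / 2) ^ 2 * (u ⬝ᵥ u) * (u ⬝ᵥ u) = (θ * n / 2) ^ 2 * (u ⬝ᵥ u) ^ 2 := by ring
        _ ≤ (μ + p) ^ 2 * (u ⬝ᵥ u) ^ 2 := mul_le_mul_of_nonneg_right h4 (sq_nonneg _)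
        _ = ((μ + p) * (u ⬝ᵥ u)) ^ 2 := by ring
        _ ≤ (u ⬝ᵥ u) * (K ^ 2 * V) := h3.trans (mul_le_mul_of_nonneg_left hWv hu0)
        _ = _ := by ring
    have h6 := le_of_mul_le_mul_right h5 h0
    rw [le_div_iff₀ (by positivity), div_mul_eq_mul_div, le_div_iff₀ (by positivity)]
    linarith [h6]
  set w := a • (1 : ι → ℝ) + u with hw
  have hww : w ⬝ᵥ w = n * a ^ 2 + u ⬝ᵥ u := by
    rw [hw, add_dotProduct, dotProduct_add, dotProduct_add, smul_dotProduct, smul_dotProduct,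
      dotProduct_smul, dotProduct_smul, dotProduct_comm 1 u, hu1, hone]
    simp only [smul_eq_mul]; ring
  set Q := 1 / q ^ 2 + 1 / θ ^ 2 with hQ
  have hwle : w ⬝ᵥ w ≤ 4 * K ^ 2 * Q * V / n ^ 2 := by
    have : 4 * K ^ 2 * Q * V / n ^ 2 =
      4 * K ^ 2 / q ^ 2 * V / n ^ 2 + 4 * K ^ 2 / θ ^ 2 * V / n ^ 2 := by rw [hQ]; ring
    rw [hww, this]
    exact add_le_add hab huu
  -- `hK3` says exactly that the bound on |w|² is at most V/2, so at least half of the mass of `v`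
  -- lies along σ.
  have hbV : V ≤ 2 * (n * b ^ 2) := by
    have h1 : 4 * K ^ 2 * Q * V / n ^ 2 ≤ V / 2 := by
      rw [div_le_iff₀ (by positivity)]
      nlinarith
    linarith
  have hb0 : b ≠ 0 := by
    rintro h0
    rw [h0] at hbV
    norm_num at hbV
    linarith
  have hbsq : 0 < b ^ 2 := by positivity
  -- Splitting Wv = bWσ + Ww, the first term combines with bθnσ into b(Aσ + pσ); only Ww, which is
  -- of second order in the noise, is left as error.
  refine ⟨b, (p + q) / 2 * (a * n), b⁻¹ • W.mulVec w, hb0, ?_, fun i => ?_⟩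
  · rw [smul_dotProduct, dotProduct_smul]
    simp only [smul_eq_mul]
    have h1 : W.mulVec w ⬝ᵥ W.mulVec w * n ≤ 8 * K ^ 4 * Q * b ^ 2 := by
      calc _ ≤ K ^ 2 * (4 * K ^ 2 * Q * V / n ^ 2) * n := by
            have := (hW.2 w).trans (mul_le_mul_of_nonneg_left hwle (sq_nonneg K))
            exact mul_le_mul_of_nonneg_right this hn0.le
        _ = 4 * K ^ 4 * Q * V / n := by field_simp
        _ ≤ 4 * K ^ 4 * Q * (2 * (n * b ^ 2)) / n := by
            have : 0 ≤ Q := by positivity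
            gcongr
        _ = _ := by field_simp; ring
    calc b⁻¹ * (b⁻¹ * (W.mulVec w ⬝ᵥ W.mulVec w)) * n
        = (W.mulVec w ⬝ᵥ W.mulVec w * n) / b ^ 2 := by field_simp
      _ ≤ _ := by rw [div_le_iff₀ hbsq]; exact h1
  · have h1 := congrFun heq i
    have h2 : W.mulVec v = W.mulVec w + b • W.mulVec σ := by
      rw [← Matrix.mulVec_smul, ← Matrix.mulVec_add]
      congr 1
      rw [hw]; conv_lhs => rw [hvdec]
      abel
    rw [h2] at h1
    have h3 := congrFun (h.mulVec_eq σ) i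
    rw [h.one_dot_sign, h.sign_dot_self] at h3
    simp only [Pi.add_apply, Pi.sub_apply, Pi.smul_apply, smul_eq_mul, Pi.one_apply, mul_one] at h1 h3 ⊢
    rw [h1, h3, mul_add b _ (b⁻¹ * _), ← mul_assoc b b⁻¹, mul_inv_cancel₀ hb0]
    ring

end IsNoisyBlock

end Perturbation

/-! ### Order of the eigenvector entries for a fixed graph. -/

section Deterministic

/-- By `hJ` some strongly attached `j` with `τ j = 1` lies outside `S` and has a small error. Any `i
∈ S` with a small error has a score no lower than that of `j`: if `τ i = 1` this forces `T ≤ D i`,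
the two errors costing less than 2t, and if `τ i = -1` it forces `D i < 0`. -/
theorem card_le_of_order {ι : Type*} [Fintype ι] [DecidableEq ι] {τ D r : ι → ℝ} {S : Finset ι}
    {T t p : ℝ} (hT : 0 ≤ T) (ht : 0 < t) (hp : 0 ≤ p) (hτ : ∀ i, τ i = 1 ∨ τ i = -1)
    (hS : ∀ i ∈ S, ∀ j ∉ S, τ j * (D j + p) + r j ≤ τ i * (D i + p) + r i)
    (hJ : S.card + (Finset.univ.filter fun i => t ≤ |r i|).card <
      (Finset.univ.filter fun j => τ j = 1 ∧ T + 3 * t ≤ D j).card) :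
    S.card ≤ (S.filter fun i => T ≤ D i).card + (Finset.univ.filter fun i => t ≤ |r i|).card +
      (Finset.univ.filter fun i => D i < 0).card := by
  set B := Finset.univ.filter fun i => t ≤ |r i| with hB
  set N := Finset.univ.filter fun i => D i < 0 with hN
  obtain ⟨j, hj, hjS⟩ : ∃ j ∈ Finset.univ.filter fun j => τ j = 1 ∧ T + 3 * t ≤ D j, j ∉ S ∪ B := by
    by_contra! hcon
    have := Finset.card_le_card (show _ ⊆ S ∪ B from hcon)
    have := Finset.card_union_le S B
    omega
  simp only [Finset.mem_filter, Finset.mem_univ, true_and, Finset.mem_union, not_or, hB,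
    not_le] at hj hjS
  have hsub : S ⊆ (S.filter fun i => T ≤ D i) ∪ B ∪ N := by
    intro i hi
    simp only [Finset.mem_union, Finset.mem_filter, Finset.mem_univ, true_and, hB, hN]
    by_contra! hcon
    obtain ⟨⟨h1, h2⟩, h3⟩ := hcon
    have h1 := h1 hi
    have h4 := hS i hi j hjS.1
    rw [hj.1] at h4
    have h5 := abs_lt.1 hjS.2
    have h6 := abs_lt.1 h2
    rcases hτ i with h | h <;> rw [h] at h4 <;> linarith [hj.2]
  calc S.card ≤ _ := Finset.card_le_card hsub
    _ ≤ _ := (Finset.card_union_le _ _).trans (Nat.add_le_add_right (Finset.card_union_le _ _) _)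

/-- The cluster of a vertex, as a sign. -/
def clusterSign {n : ℕ} (i : Fin n) : ℝ := if (i : ℕ) < n / 2 then 1 else -1

open Classical in
/-- The adjacency matrix minus its expectation. -/
def noiseMatrix {n : ℕ} (p q : ℝ) (G : SimpleGraph (Fin n)) : Matrix (Fin n) (Fin n) ℝ :=
  fun i j => if i = j then 0 else
    (if G.Adj i j then 1 else 0) - (if SameCluster i j then p else q)

theorem clusterSign_eq {n : ℕ} (i : Fin n) : clusterSign i = 1 ∨ clusterSign i = -1 := by
  unfold clusterSign; split_ifs <;> simp

theorem sum_clusterSign {n : ℕ} (hn : Even n) : ∑ i : Fin n, clusterSign i = 0 := by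
  obtain ⟨m, rfl⟩ := hn
  have h : (m + m) / 2 = m := by omega
  simp only [clusterSign, h]
  rw [Fin.sum_univ_eq_sum_range (fun i => if i < m then (1 : ℝ) else -1),
    Finset.sum_range_add]
  have h1 : ∑ i ∈ Finset.range m, (if i < m then (1 : ℝ) else -1) = ∑ _i ∈ Finset.range m, 1 :=
    Finset.sum_congr rfl fun i hi => if_pos (Finset.mem_range.1 hi)
  rw [h1]
  simp

theorem clusterSign_mul {n : ℕ} (i j : Fin n) [Decidable (SameCluster i j)] :
    clusterSign i * clusterSign j = if SameCluster i j then 1 else -1 := by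
  unfold clusterSign SameCluster
  by_cases h1 : (i : ℕ) < n / 2 <;> by_cases h2 : (j : ℕ) < n / 2 <;> simp [h1, h2]

open Classical in
theorem isNoisyBlock_adjMatrix {n : ℕ} (hn : Even n) (p q : ℝ) (G : SimpleGraph (Fin n)) :
    IsNoisyBlock p q clusterSign (G.adjMatrix ℝ) (noiseMatrix p q G) where
  sign := clusterSign_eq
  balanced := sum_clusterSign hn
  apply_eq i j := by
    rw [clusterSign_mul]
    simp only [SimpleGraph.adjMatrix_apply, noiseMatrix]
    by_cases h : i = j
    · subst h
      simp [SameCluster]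
      ring
    · simp only [h, if_false]
      split_ifs <;> ring

open Classical in
theorem clusterSign_mul_attachment {n : ℕ} (G : SimpleGraph (Fin n)) (i : Fin n) :
    (G.adjMatrix ℝ).mulVec clusterSign i = clusterSign i * attachment G i := by
  have h : attachment G i = ∑ j, (if G.Adj i j then clusterSign i * clusterSign j else 0) := by
    unfold attachment
    rw [Finset.card_filter, Finset.card_filter, Nat.cast_sum, Nat.cast_sum,
      ← Finset.sum_sub_distrib]
    refine Finset.sum_congr rfl fun j _ => ?_
    rw [clusterSign_mul]
    by_cases h1 : G.Adj i j <;> by_cases h2 : SameCluster i j <;> simp [h1, h2]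
  rw [h, Finset.mul_sum]
  simp only [Matrix.mulVec, dotProduct, SimpleGraph.adjMatrix_apply]
  refine Finset.sum_congr rfl fun j _ => ?_
  rcases clusterSign_eq i with h | h <;> rw [h] <;> split_ifs <;> simp

theorem attachment_add_eq {n : ℕ} (hn : Even n) (p q : ℝ) (G : SimpleGraph (Fin n)) (i : Fin n) :
    attachment G i + p =
      (p - q) / 2 * n + clusterSign i * (noiseMatrix p q G).mulVec clusterSign i := by
  classical
  have h := isNoisyBlock_adjMatrix hn p q G
  have h1 := congrFun (h.mulVec_eq clusterSign) i
  rw [h.one_dot_sign, h.sign_dot_self, clusterSign_mul_attachment] at h1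
  simp only [Pi.add_apply, Pi.sub_apply, Pi.smul_apply, smul_eq_mul, Pi.one_apply,
    Fintype.card_fin, mul_zero, zero_mul, zero_add] at h1
  rcases clusterSign_eq i with h | h <;> rw [h] at h1 ⊢ <;> linarith

/-- A bound for the number of vertices that a graph whose noise has operator norm `K √n` can have
outside of the typical behavior. -/
def exceptionBound (p q K : ℝ) : ℝ :=
  8 * K ^ 4 * (1 / q ^ 2 + 1 / ((p - q) / 2) ^ 2) + 4 * K ^ 2 / ((p - q) / 2) ^ 2

-- The two terms of `exceptionBound` count the vertices with a large error ρ_i and those with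
-- negative attachment. `hk` makes them at most 1% of the extreme set, and `hJ` supplies the
-- comparison vertex in either cluster.
open Classical in
theorem mostlyAttached_of_normBound {n : ℕ} (hn : Even n) {p q η K : ℝ} (hn2 : 2 ≤ n)
    (hq : 0 < q) (hqp : q < p) (hη : 0 ≤ η) {G : SimpleGraph (Fin n)}
    (hW : NormBound (noiseMatrix p q G) (K * √n))
    (h1 : K * √n ≤ (p - q) / 4 * n) (h2 : K * √n ≤ q / 2 * n)
    (h3 : 8 * K ^ 2 * (1 / q ^ 2 + 1 / ((p - q) / 2) ^ 2) ≤ n) (h4 : p ≤ (p - q) / 4 * n)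
    {k : ℕ} (hk : exceptionBound p q K ≤ k / 100)
    (hJ : ∀ s : ℝ, s = 1 ∨ s = -1 → k + exceptionBound p q K <
      ((Finset.univ.filter fun j : Fin n => clusterSign j = s ∧
        (p - q) * n / 2 + (η + 3) * √n ≤ attachment G j).card : ℝ))
    {v : Fin n → ℝ} (hv : IsSecondEigenvector G v) {S : Finset (Fin n)}
    (hS : IsTopSet v k S ∨ IsBottomSet v k S) : MostlyAttached p q η G S := by
  have hnoisy := isNoisyBlock_adjMatrix hn p q G
  obtain ⟨hv0, hA, hcard, hAv⟩ := hv
  have hn0 : (0 : ℝ) < n := by exact_mod_cast (by omega : 0 < n)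
  have hsq : √(n : ℝ) ^ 2 = n := Real.sq_sqrt hn0.le
  have hsq0 : 0 < √(n : ℝ) := Real.sqrt_pos.2 hn0
  have hθ0 : 0 < (p - q) / 2 := by linarith
  have hμ := hnoisy.abs_second_eigenvalue_sub_le hW hA hcard hq.le hqp.le
  set Q := 1 / q ^ 2 + 1 / ((p - q) / 2) ^ 2 with hQ
  obtain ⟨hpos, b, α, ρ, hb, hρ, hexp⟩ := hnoisy.eigenvector_expansion hW hq hqp hv0 hAv hμ
    (by simpa using h1) (by simpa using h2) (by
      rw [mul_pow, hsq, Fintype.card_fin]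
      calc 8 * (K ^ 2 * (n : ℝ)) * Q = (8 * K ^ 2 * Q) * n := by ring
        _ ≤ (n : ℝ) * n := mul_le_mul_of_nonneg_right h3 hn0.le
        _ = _ := by ring)
  set κ := hA.eigenvalues₀ ⟨1, hcard⟩ + p
  have hρ' : ρ ⬝ᵥ ρ ≤ 8 * K ^ 4 * Q * n := by
    rw [Fintype.card_fin] at hρ
    refine le_of_mul_le_mul_right (hρ.trans (le_of_eq ?_)) hn0
    rw [← hQ, mul_pow, show √(n : ℝ) ^ 4 = (√(n : ℝ) ^ 2) ^ 2 by ring, hsq]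
    ring
  have hB : ((Finset.univ.filter fun i => √(n : ℝ) ≤ |ρ i|).card : ℝ) ≤ 8 * K ^ 4 * Q := by
    have := card_filter_abs_ge_mul_sq_le ρ hsq0.le (Finset.univ.filter fun i => √(n : ℝ) ≤ |ρ i|)
      (by simp)
    rw [hsq] at this
    exact le_of_mul_le_mul_right (this.trans hρ') hn0
  -- Negative attachment forces |(Wσ)_i| ≥ (p-q)n/4, while |Wσ|² ≤ K²n².
  have hN : ((Finset.univ.filter fun i => attachment G i < 0).card : ℝ) ≤
      4 * K ^ 2 / ((p - q) / 2) ^ 2 := by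
    have h5 := card_filter_abs_ge_mul_sq_le ((noiseMatrix p q G).mulVec clusterSign)
      (t := (p - q) / 4 * n) (by positivity) (Finset.univ.filter fun i => attachment G i < 0) (by
        intro i hi
        have hi := (Finset.mem_filter.1 hi).2
        have := attachment_add_eq hn p q G i
        rcases clusterSign_eq i with h | h <;> rw [h] at this
        · refine le_trans ?_ (neg_le_abs _); linarith
        · refine le_trans ?_ (le_abs_self _); linarith)
    have h6 := hW.2 clusterSign
    rw [hnoisy.sign_dot_self, mul_pow, hsq, Fintype.card_fin] at h6
    rw [le_div_iff₀ (by positivity)]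
    have h7 := h5.trans h6
    have h8 : 0 < (n : ℝ) ^ 2 := by positivity
    refine le_of_mul_le_mul_right (le_trans (le_of_eq ?_) (mul_le_mul_of_nonneg_left h7
      (by norm_num : (0 : ℝ) ≤ 4)) |>.trans (le_of_eq ?_)) h8 <;> ring
  have hQ0 : 0 ≤ Q := by positivity
  -- a common sign turns the order of the entries of `v` into that of `τ i * (attachment + p)`
  have main : ∀ s : ℝ, s = 1 ∨ s = -1 → S.card = k →
      (∀ i ∈ S, ∀ j ∉ S, s * b * v j ≤ s * b * v i) → MostlyAttached p q η G S := by
    intro s hs hSk hord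
    have hJs := hJ s hs
    have hBr : (Finset.univ.filter fun i => √(n : ℝ) ≤ |s * ρ i|) =
        (Finset.univ.filter fun i => √(n : ℝ) ≤ |ρ i|) := by
      rcases hs with rfl | rfl <;> simp
    have hτJ : (Finset.univ.filter fun j : Fin n => s * clusterSign j = 1 ∧
          (p - q) * n / 2 + η * √n + 3 * √n ≤ attachment G j) =
        (Finset.univ.filter fun j : Fin n => clusterSign j = s ∧
          (p - q) * n / 2 + (η + 3) * √n ≤ attachment G j) := by
      ext j
      simp only [Finset.mem_filter, Finset.mem_univ, true_and, add_mul, add_assoc]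
      rcases hs with rfl | rfl
      · simp
      · rcases clusterSign_eq j with h | h <;> rw [h] <;> norm_num
    have hcount := card_le_of_order (τ := fun i => s * clusterSign i) (D := attachment G)
      (r := fun i => s * ρ i) (S := S) (T := (p - q) * n / 2 + η * √n) (t := √(n : ℝ)) (p := p)
      (by positivity) hsq0 (by linarith) (fun i => by
        rcases hs with rfl | rfl <;> rcases clusterSign_eq i with h | h <;> rw [h] <;> norm_num)
      (fun i hi j hj => by
        have h5 := mul_le_mul_of_nonneg_left (hord i hi j hj) hpos.le
        -- The factor `s * b` makes the coefficient of the scores equal to b², hence positive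
        -- whatever the sign of `b`.
        have h6 : ∀ i, κ * (s * b * v i) = s * b * α +
            b ^ 2 * (s * clusterSign i * (attachment G i + p) + s * ρ i) := by
          intro i
          have := hexp i
          rw [clusterSign_mul_attachment] at this
          calc κ * (s * b * v i) = s * b * (κ * v i) := by ring
            _ = _ := by rw [this]; ring
        rw [h6, h6] at h5
        exact le_of_mul_le_mul_left (by linarith) (by positivity : 0 < b ^ 2))
      (by
        rw [hBr, hτJ, hSk]
        have : (k : ℝ) + ((Finset.univ.filter fun i => √(n : ℝ) ≤ |ρ i|).card : ℝ) <
            ((Finset.univ.filter fun j : Fin n => clusterSign j = s ∧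
              (p - q) * n / 2 + (η + 3) * √n ≤ attachment G j).card : ℝ) := by
          refine lt_of_le_of_lt ?_ hJs
          have : 0 ≤ 4 * K ^ 2 / ((p - q) / 2) ^ 2 := by positivity
          unfold exceptionBound
          linarith
        exact_mod_cast this)
    rw [hBr] at hcount
    have hcount' : (S.card : ℝ) ≤ ((S.filter fun i =>
        (p - q) * n / 2 + η * √n ≤ attachment G i).card : ℝ) +
        ((Finset.univ.filter fun i => √(n : ℝ) ≤ |ρ i|).card : ℝ) +
        ((Finset.univ.filter fun i => attachment G i < 0).card : ℝ) := by exact_mod_cast hcount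
    unfold MostlyAttached
    unfold exceptionBound at hk
    rw [← hSk] at hk
    linarith
  -- The sign `s` is that of `b` for a top set and the opposite for a bottom set; it names the
  -- cluster that fills the set.
  rcases hS with ⟨hSk, hS⟩ | ⟨hSk, hS⟩ <;> rcases lt_or_gt_of_ne hb with hb | hb
  · refine main (-1) (Or.inr rfl) hSk fun i hi j hj => ?_
    have := hS i hi j hj
    nlinarith
  · refine main 1 (Or.inl rfl) hSk fun i hi j hj => ?_
    have := hS i hi j hj
    nlinarith
  · refine main 1 (Or.inl rfl) hSk fun i hi j hj => ?_
    have := hS i hi j hj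
    nlinarith
  · refine main (-1) (Or.inr rfl) hSk fun i hi j hj => ?_
    have := hS i hi j hj
    nlinarith

end Deterministic

/-! ### Nets of the unit ball and the operator norm. -/

section Net

/-- A 1/2-separated subset of the ball of maximal size is a net. Scaled by 2 it is 1-separated in
the ball of radius 2, where the volume bound is 5 to the dimension. -/
theorem exists_half_net (ι : Type*) [Fintype ι] :
    ∃ N : Finset (EuclideanSpace ℝ ι), N.card ≤ 5 ^ Fintype.card ι ∧ (∀ y ∈ N, ‖y‖ ≤ 1) ∧
      ∀ x : EuclideanSpace ℝ ι, ‖x‖ ≤ 1 → ∃ y ∈ N, ‖x - y‖ ≤ 1 / 2 := by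
  classical
  let Good : Finset (EuclideanSpace ℝ ι) → Prop := fun s =>
    (∀ c ∈ s, ‖c‖ ≤ 1) ∧ ∀ c ∈ s, ∀ d ∈ s, c ≠ d → 1 / 2 ≤ ‖c - d‖
  have hcard : ∀ s, Good s → s.card ≤ 5 ^ Fintype.card ι := by
    intro s hs
    have hinj : Function.Injective fun x : EuclideanSpace ℝ ι => (2 : ℝ) • x :=
      smul_right_injective _ two_ne_zero
    have := Besicovitch.card_le_of_separated (s.map ⟨_, hinj⟩) (by
        intro c hc
        obtain ⟨d, hd, rfl⟩ := Finset.mem_map.1 hc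
        have := hs.1 d hd
        simp only [Function.Embedding.coeFn_mk, norm_smul, Real.norm_ofNat]
        linarith) (by
        intro c hc d hd hcd
        obtain ⟨c, hc', rfl⟩ := Finset.mem_map.1 hc
        obtain ⟨d, hd', rfl⟩ := Finset.mem_map.1 hd
        have := hs.2 c hc' d hd' (fun h => hcd (by rw [h]))
        simp only [Function.Embedding.coeFn_mk, ← smul_sub, norm_smul, Real.norm_ofNat]
        linarith)
    simpa using this
  obtain ⟨m, ⟨N, hN, rfl⟩, hmax⟩ : ∃ m ∈ {m : ℕ | ∃ s, Good s ∧ s.card = m},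
      ∀ k ∈ {m : ℕ | ∃ s, Good s ∧ s.card = m}, k ≤ m := by
    have hne : {m : ℕ | ∃ s, Good s ∧ s.card = m}.Nonempty :=
      ⟨0, ∅, ⟨by simp, by simp⟩, rfl⟩
    have hbdd : BddAbove {m : ℕ | ∃ s, Good s ∧ s.card = m} :=
      ⟨_, by rintro _ ⟨s, hs, rfl⟩; exact hcard s hs⟩
    exact ⟨_, Nat.sSup_mem hne hbdd, fun k hk => le_csSup hbdd hk⟩
  refine ⟨N, hcard N hN, hN.1, fun x hx => ?_⟩
  by_contra! hcon
  have hxN : x ∉ N := fun h => by have := hcon x h; norm_num at this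
  have := hmax _ ⟨insert x N, ⟨?_, ?_⟩, rfl⟩
  · rw [Finset.card_insert_of_notMem hxN] at this; omega
  · intro c hc
    rcases Finset.mem_insert.1 hc with rfl | hc
    exacts [hx, hN.1 c hc]
  · intro c hc d hd hcd
    rcases Finset.mem_insert.1 hc with rfl | hc' <;> rcases Finset.mem_insert.1 hd with rfl | hd'
    · exact absurd rfl hcd
    · exact (hcon d hd').le
    · rw [norm_sub_rev]; exact (hcon c hc').le
    · exact hN.2 c hc' d hd' hcd

theorem norm_le_of_inner_le {E : Type*} [NormedAddCommGroup E] [InnerProductSpace ℝ E]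
    {N : Finset E} (hN : ∀ x : E, ‖x‖ ≤ 1 → ∃ y ∈ N, ‖x - y‖ ≤ 1 / 2) {z : E} {t : ℝ}
    (hz : ∀ y ∈ N, inner ℝ y z ≤ t) : ‖z‖ ≤ 2 * t := by
  have hx : ‖‖z‖⁻¹ • z‖ ≤ 1 := by
    rw [norm_smul, norm_inv, norm_norm]
    exact inv_mul_le_one
  obtain ⟨y, hy, hd⟩ := hN _ hx
  have h1 : inner ℝ (‖z‖⁻¹ • z) z = ‖z‖ := by
    rw [real_inner_smul_left, real_inner_self_eq_norm_sq]
    rcases eq_or_ne ‖z‖ 0 with h | h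
    · simp [h]
    · field_simp
  have h2 : inner ℝ (‖z‖⁻¹ • z - y) z ≤ 1 / 2 * ‖z‖ :=
    (real_inner_le_norm _ _).trans (mul_le_mul_of_nonneg_right hd (norm_nonneg _))
  rw [inner_sub_left, h1] at h2
  linarith [hz y hy]

theorem opNorm_le_of_net {E : Type*} [NormedAddCommGroup E] [InnerProductSpace ℝ E]
    {N : Finset E} (hN : ∀ x : E, ‖x‖ ≤ 1 → ∃ y ∈ N, ‖x - y‖ ≤ 1 / 2) (L : E →L[ℝ] E) {t : ℝ}
    (ht : 0 ≤ t) (hL : ∀ y ∈ N, ‖L y‖ ≤ t) : ‖L‖ ≤ 2 * t := by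
  have : ‖L‖ ≤ t + ‖L‖ / 2 := by
    refine L.opNorm_le_of_unit_norm (by positivity) fun x hx => ?_
    obtain ⟨y, hy, hd⟩ := hN x hx.le
    calc ‖L x‖ = ‖L y + L (x - y)‖ := by rw [← map_add, add_sub_cancel]
      _ ≤ ‖L y‖ + ‖L (x - y)‖ := norm_add_le _ _
      _ ≤ t + ‖L‖ * (1 / 2) := add_le_add (hL y hy)
          ((L.le_opNorm _).trans (mul_le_mul_of_nonneg_left hd (norm_nonneg _)))
      _ = _ := by ring
  linarith

/-- Discretizing each of the two arguments of the bilinear form costs a factor 2. -/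
theorem normBound_of_net {ι : Type*} [Fintype ι] [DecidableEq ι]
    {N : Finset (EuclideanSpace ℝ ι)}
    (hN : ∀ x : EuclideanSpace ℝ ι, ‖x‖ ≤ 1 → ∃ y ∈ N, ‖x - y‖ ≤ 1 / 2) {W : Matrix ι ι ℝ} {t : ℝ}
    (ht : 0 ≤ t) (hW : ∀ x ∈ N, ∀ y ∈ N, x.ofLp ⬝ᵥ W.mulVec y.ofLp ≤ t) :
    NormBound W (4 * t) := by
  have hdot : ∀ x y : EuclideanSpace ℝ ι, inner ℝ x y = x.ofLp ⬝ᵥ y.ofLp := by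
    intro x y
    rw [EuclideanSpace.inner_eq_star_dotProduct, dotProduct_comm]
    simp
  let L := Matrix.toEuclideanCLM (𝕜 := ℝ) W
  have hL : ∀ x, (L x).ofLp = W.mulVec x.ofLp := fun x => Matrix.ofLp_toEuclideanCLM W x
  have h : ‖L‖ ≤ 2 * (2 * t) := opNorm_le_of_net hN L (by positivity) fun y hy =>
    norm_le_of_inner_le hN fun x hx => by rw [hdot, hL]; exact hW x hx y hy
  refine ⟨by positivity, fun x => ?_⟩
  have h1 := (L.le_opNorm (WithLp.toLp 2 x)).trans (mul_le_mul_of_nonneg_right h (norm_nonneg _))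
  have h2 := pow_le_pow_left₀ (norm_nonneg _) h1 2
  rw [mul_pow, ← real_inner_self_eq_norm_sq, ← real_inner_self_eq_norm_sq, hdot, hdot, hL] at h2
  calc _ ≤ _ := h2
    _ = _ := by ring

end Net

/-! ### Independence and subgaussian tails of the edge indicators. -/

section EdgeLaw

variable {n : ℕ} {p q : ℝ}

theorem edgeProb_mem (hp : p ∈ Set.Icc (0 : ℝ) 1) (hq : q ∈ Set.Icc (0 : ℝ) 1)
    (e : VertexPair n) : edgeProb p q e ∈ Set.Icc (0 : ℝ) 1 := by
  unfold edgeProb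
  split_ifs <;> assumption

/-- The Bernoulli law on `Bool`. -/
def coin (r : ℝ) : Measure Bool :=
  ENNReal.ofReal r • Measure.dirac true + ENNReal.ofReal (1 - r) • Measure.dirac false

theorem isProbabilityMeasure_coin {r : ℝ} (hr : r ∈ Set.Icc (0 : ℝ) 1) :
    IsProbabilityMeasure (coin r) := by
  constructor
  simp [coin, ← ENNReal.ofReal_add hr.1 (sub_nonneg.2 hr.2)]

theorem integral_coin {r : ℝ} (hr : r ∈ Set.Icc (0 : ℝ) 1) (f : Bool → ℝ) :
    ∫ x, f x ∂(coin r) = r * f true + (1 - r) * f false := by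
  have := isProbabilityMeasure_coin hr
  unfold coin
  rw [integral_add_measure, integral_smul_measure, integral_smul_measure, integral_dirac,
    integral_dirac, ENNReal.toReal_ofReal hr.1, ENNReal.toReal_ofReal (sub_nonneg.2 hr.2)]
  · rfl
  · exact (integrable_dirac (by simp)).smul_measure (by simp)
  · exact (integrable_dirac (by simp)).smul_measure (by simp)

theorem edgeLaw_eq : edgeLaw n p q = Measure.pi fun e => coin (edgeProb p q e) := rfl

theorem isProbabilityMeasure_edgeLaw (hp : p ∈ Set.Icc (0 : ℝ) 1) (hq : q ∈ Set.Icc (0 : ℝ) 1) :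
    IsProbabilityMeasure (edgeLaw n p q) := by
  have := fun e : VertexPair n => isProbabilityMeasure_coin (edgeProb_mem hp hq e)
  rw [edgeLaw_eq]
  infer_instance

theorem iIndepFun_eval_edgeLaw (hp : p ∈ Set.Icc (0 : ℝ) 1) (hq : q ∈ Set.Icc (0 : ℝ) 1) :
    iIndepFun (fun (e : VertexPair n) (ω : VertexPair n → Bool) => ω e) (edgeLaw n p q) := by
  have := fun e : VertexPair n => isProbabilityMeasure_coin (edgeProb_mem hp hq e)
  rw [edgeLaw_eq]
  exact iIndepFun_pi (X := fun _ x => x) fun _ => aemeasurable_id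

theorem map_eval_edgeLaw (hp : p ∈ Set.Icc (0 : ℝ) 1) (hq : q ∈ Set.Icc (0 : ℝ) 1)
    (e : VertexPair n) : (edgeLaw n p q).map (fun ω => ω e) = coin (edgeProb p q e) := by
  have := fun e : VertexPair n => isProbabilityMeasure_coin (edgeProb_mem hp hq e)
  rw [edgeLaw_eq]
  exact (measurePreserving_eval (fun e : VertexPair n => coin (edgeProb p q e)) e).map_eq

/-- The centered indicator of a biased coin. -/
def centered (r : ℝ) (x : Bool) : ℝ := (if x then 1 else 0) - r

/-- The centered indicator of an edge. -/
def edgeNoise (p q : ℝ) (e : VertexPair n) (ω : VertexPair n → Bool) : ℝ :=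
  centered (edgeProb p q e) (ω e)

theorem iIndepFun_edgeNoise (hp : p ∈ Set.Icc (0 : ℝ) 1) (hq : q ∈ Set.Icc (0 : ℝ) 1) :
    iIndepFun (fun e : VertexPair n => edgeNoise p q e) (edgeLaw n p q) :=
  (iIndepFun_eval_edgeLaw hp hq).comp (fun e => centered (edgeProb p q e))
    fun _ => Measurable.of_discrete

theorem hasSubgaussianMGF_edgeNoise (hp : p ∈ Set.Icc (0 : ℝ) 1) (hq : q ∈ Set.Icc (0 : ℝ) 1)
    (e : VertexPair n) : HasSubgaussianMGF (edgeNoise p q e) (1 / 4) (edgeLaw n p q) := by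
  have := isProbabilityMeasure_edgeLaw (n := n) hp hq
  have h := hasSubgaussianMGF_of_mem_Icc (μ := edgeLaw n p q) (a := 0) (b := 1)
    (X := fun ω : VertexPair n → Bool => if ω e then 1 else 0)
    (Measurable.of_discrete.aemeasurable)
    (ae_of_all _ fun ω => by split_ifs <;> simp)
  have h2 : ∫ ω, (if ω e then (1 : ℝ) else 0) ∂(edgeLaw n p q) = edgeProb p q e := by
    have := integral_map (μ := edgeLaw n p q) (φ := fun ω => ω e)
      (f := fun x : Bool => if x then (1 : ℝ) else 0) Measurable.of_discrete.aemeasurable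
      (Measurable.of_discrete.aestronglyMeasurable)
    rw [← this, map_eval_edgeLaw hp hq, integral_coin (edgeProb_mem hp hq e)]
    simp
  rw [h2] at h
  convert! h using 1
  ext
  norm_num

theorem measureReal_sum_edgeNoise_ge_le (hp : p ∈ Set.Icc (0 : ℝ) 1)
    (hq : q ∈ Set.Icc (0 : ℝ) 1) (c : VertexPair n → ℝ) {s t : ℝ} (hc : ∑ e, c e ^ 2 ≤ s)
    (hs : 0 < s) (ht : 0 ≤ t) :
    (edgeLaw n p q).real {ω | t ≤ ∑ e, c e * edgeNoise p q e ω} ≤ Real.exp (-(2 * t ^ 2 / s)) := by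
  have := isProbabilityMeasure_edgeLaw (n := n) hp hq
  have hind : iIndepFun (fun (e : VertexPair n) ω => c e * edgeNoise p q e ω) (edgeLaw n p q) :=
    (iIndepFun_edgeNoise hp hq).comp (fun e x => c e * x) fun e => by fun_prop
  have h1 := HasSubgaussianMGF.sum_of_iIndepFun hind (s := Finset.univ)
    fun e _ => (hasSubgaussianMGF_edgeNoise hp hq e).const_mul (c e)
  have h2 : HasSubgaussianMGF (fun ω => ∑ e, c e * edgeNoise p q e ω) (s / 4).toNNReal
      (edgeLaw n p q) := by
    -- The subgaussian parameter may be enlarged, here from the exact ∑ c_e²/4 to s/4.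
    refine ⟨h1.integrable_exp_mul, fun u => (h1.mgf_le u).trans (Real.exp_le_exp.2 ?_)⟩
    have : ((∑ e : VertexPair n, ⟨c e ^ 2, sq_nonneg _⟩ * (1 / 4) : NNReal) : ℝ) ≤
        ((s / 4).toNNReal : ℝ) := by
      rw [Real.coe_toNNReal _ (by positivity)]
      have h3 : ∀ e, ((⟨c e ^ 2, sq_nonneg _⟩ * (1 / 4) : NNReal) : ℝ) = c e ^ 2 * (1 / 4) := by
        intro e
        change c e ^ 2 * ((1 / 4 : NNReal) : ℝ) = _
        norm_num
      rw [NNReal.coe_sum, Finset.sum_congr rfl fun e _ => h3 e, ← Finset.sum_mul]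
      linarith
    gcongr
  refine (h2.measure_ge_le ht).trans (le_of_eq ?_)
  rw [Real.coe_toNNReal _ (by positivity)]
  congr 1
  field_simp
  norm_num

end EdgeLaw

/-! ### Operator norm of the noise. -/

section OperatorNorm

variable {n : ℕ} {p q : ℝ}

theorem noiseMatrix_graphOf_of_lt (ω : VertexPair n → Bool) {i j : Fin n} (h : i < j) :
    noiseMatrix p q (graphOf ω) i j = edgeNoise p q ⟨(i, j), h⟩ ω := by
  have h2 : ¬ j < i := h.asymm
  simp [noiseMatrix, edgeNoise, centered, edgeProb, graphOf, h.ne, h, h2]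

open Classical in
theorem noiseMatrix_comm (G : SimpleGraph (Fin n)) (i j : Fin n) :
    noiseMatrix p q G i j = noiseMatrix p q G j i := by
  have : SameCluster i j ↔ SameCluster j i := Iff.comm
  by_cases h : i = j
  · rw [h]
  · rw [noiseMatrix, noiseMatrix, if_neg h, if_neg (Ne.symm h)]
    congr 1
    · exact if_congr (G.adj_comm i j) rfl rfl
    · exact if_congr this rfl rfl

theorem noiseMatrix_self (G : SimpleGraph (Fin n)) (i : Fin n) : noiseMatrix p q G i i = 0 := by
  simp [noiseMatrix]

theorem sum_vertexPair (g : Fin n → Fin n → ℝ) :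
    ∑ e : VertexPair n, (g e.1.1 e.1.2 + g e.1.2 e.1.1) = (∑ i, ∑ j, g i j) - ∑ i, g i i := by
  have h1 : ∀ f : Fin n × Fin n → ℝ, ∑ e : VertexPair n, f e.1 =
      ∑ x : Fin n × Fin n, if x.1 < x.2 then f x else 0 := by
    intro f
    rw [← Finset.sum_filter]
    exact (Finset.sum_subtype _ (by simp) f).symm
  have h2 : ∑ x : Fin n × Fin n, (if x.1 < x.2 then g x.2 x.1 else 0) =
      ∑ x : Fin n × Fin n, if x.2 < x.1 then g x.1 x.2 else 0 :=
    (Equiv.prodComm _ _).sum_comp fun x : Fin n × Fin n => if x.2 < x.1 then g x.1 x.2 else 0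
  have h3 : ∑ i, g i i = ∑ x : Fin n × Fin n, if x.1 = x.2 then g x.1 x.2 else 0 := by
    rw [Fintype.sum_prod_type]
    simp
  rw [Finset.sum_add_distrib, h1 fun x => g x.1 x.2, h1 fun x => g x.2 x.1, h2, h3,
    ← Fintype.sum_prod_type', ← Finset.sum_add_distrib, ← Finset.sum_sub_distrib]
  refine Finset.sum_congr rfl fun x _ => ?_
  rcases lt_trichotomy x.1 x.2 with h | h | h
  · simp [h, h.asymm, h.ne]
  · simp [h]
  · simp [h, h.asymm, h.ne']

theorem dotProduct_noiseMatrix_mulVec (ω : VertexPair n → Bool) (x y : Fin n → ℝ) :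
    x ⬝ᵥ (noiseMatrix p q (graphOf ω)).mulVec y =
      ∑ e : VertexPair n, (x e.1.1 * y e.1.2 + x e.1.2 * y e.1.1) * edgeNoise p q e ω := by
  have h := sum_vertexPair fun i j => x i * noiseMatrix p q (graphOf ω) i j * y j
  simp only [noiseMatrix_self, mul_zero, zero_mul, Finset.sum_const_zero, sub_zero] at h
  have h2 : x ⬝ᵥ (noiseMatrix p q (graphOf ω)).mulVec y =
      ∑ i, ∑ j, x i * noiseMatrix p q (graphOf ω) i j * y j := by
    simp only [dotProduct, Matrix.mulVec, Finset.mul_sum, mul_assoc]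
  rw [h2, ← h]
  refine Finset.sum_congr rfl fun e _ => ?_
  rw [noiseMatrix_comm _ e.1.2, noiseMatrix_graphOf_of_lt ω e.2]
  ring

theorem sum_sq_coeff_le (x y : Fin n → ℝ) :
    ∑ e : VertexPair n, (x e.1.1 * y e.1.2 + x e.1.2 * y e.1.1) ^ 2 ≤
      2 * ((x ⬝ᵥ x) * (y ⬝ᵥ y)) := by
  have h := sum_vertexPair fun i j : Fin n => 2 * (x i * x i * (y j * y j))
  have h2 : ∑ i, ∑ j, 2 * (x i * x i * (y j * y j)) = 2 * ((x ⬝ᵥ x) * (y ⬝ᵥ y)) := by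
    rw [dotProduct, dotProduct, Finset.sum_mul_sum]
    simp only [Finset.mul_sum]
  have h3 : 0 ≤ ∑ i : Fin n, 2 * (x i * x i * (y i * y i)) :=
    Finset.sum_nonneg fun i _ => by have := mul_self_nonneg (x i * y i); nlinarith
  calc _ ≤ ∑ e : VertexPair n, (2 * (x e.1.1 * x e.1.1 * (y e.1.2 * y e.1.2)) +
        2 * (x e.1.2 * x e.1.2 * (y e.1.1 * y e.1.1))) :=
        Finset.sum_le_sum fun e _ => by
          nlinarith [sq_nonneg (x e.1.1 * y e.1.2 - x e.1.2 * y e.1.1)]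
    _ ≤ _ := by linarith

/-- The noise has operator norm at most `12 √n`, except with exponentially small probability. -/
theorem measureReal_not_normBound_le (hp : p ∈ Set.Icc (0 : ℝ) 1) (hq : q ∈ Set.Icc (0 : ℝ) 1) :
    (edgeLaw n p q).real {ω | ¬ NormBound (noiseMatrix p q (graphOf ω)) (12 * √n)} ≤
      Real.exp (-n) := by
  have := isProbabilityMeasure_edgeLaw (n := n) hp hq
  obtain ⟨N, hcard, hN1, hN⟩ := exists_half_net (Fin n)
  have hsub : {ω | ¬ NormBound (noiseMatrix p q (graphOf ω)) (12 * √n)} ⊆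
      ⋃ z ∈ N ×ˢ N, {ω | 3 * √n ≤ ∑ e : VertexPair n,
        (z.1.ofLp e.1.1 * z.2.ofLp e.1.2 + z.1.ofLp e.1.2 * z.2.ofLp e.1.1) *
          edgeNoise p q e ω} := by
    intro ω hω
    by_contra hcon
    refine hω ?_
    rw [show 12 * √(n : ℝ) = 4 * (3 * √n) by ring]
    refine normBound_of_net hN (by positivity) fun x hx y hy => ?_
    rw [dotProduct_noiseMatrix_mulVec]
    by_contra hlt
    exact hcon (Set.mem_biUnion (Finset.mem_product.2 ⟨hx, hy⟩ : (x, y) ∈ N ×ˢ N) (not_le.1 hlt).le)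
  have hself : ∀ z ∈ N, z.ofLp ⬝ᵥ z.ofLp ≤ 1 := by
    intro z hz
    have h := EuclideanSpace.real_norm_sq_eq z
    have h2 := hN1 z hz
    have : z.ofLp ⬝ᵥ z.ofLp = ‖z‖ ^ 2 := by rw [h]; simp [dotProduct, pow_two]
    rw [this]
    nlinarith [norm_nonneg z]
  have hn : (0 : ℝ) ≤ n := by positivity
  calc _ ≤ (edgeLaw n p q).real _ := measureReal_mono hsub (measure_ne_top _ _)
    _ ≤ ∑ z ∈ N ×ˢ N, _ := measureReal_biUnion_finset_le _ _
    -- For x, y in the unit ball the squared coefficients sum to at most 2, so the threshold 3√n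
    -- gives the exponent 2 · 9n / 2 = 9n.
    _ ≤ ∑ z ∈ N ×ˢ N, Real.exp (-(9 * n)) := Finset.sum_le_sum fun z hz => by
        obtain ⟨h1, h2⟩ := Finset.mem_product.1 hz
        refine (measureReal_sum_edgeNoise_ge_le hp hq _ (s := 2) ((sum_sq_coeff_le _ _).trans ?_)
          two_pos (by positivity)).trans (Real.exp_le_exp.2 (le_of_eq ?_))
        · have := mul_le_one₀ (hself _ h1) (dotProduct_self_nonneg_real _) (hself _ h2)
          linarith
        · rw [mul_pow, Real.sq_sqrt hn]; ring
    _ = (N.card : ℝ) * N.card * Real.exp (-(9 * n)) := by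
        rw [Finset.sum_const, Finset.card_product, nsmul_eq_mul, Nat.cast_mul]
    -- The crude bound 5 ≤ e⁴ is enough: the at most 25ⁿ pairs cost at most e^{8n}.
    _ ≤ Real.exp (4 * n) * Real.exp (4 * n) * Real.exp (-(9 * n)) := by
        have h5 : (N.card : ℝ) ≤ Real.exp (4 * n) := by
          calc (N.card : ℝ) ≤ 5 ^ n := by
                have : N.card ≤ 5 ^ n := by simpa using hcard
                exact_mod_cast this
            _ ≤ (Real.exp 4) ^ n := by
                have := Real.add_one_le_exp (4 : ℝ)
                exact pow_le_pow_left₀ (by norm_num) (by linarith) n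
            _ = _ := by rw [← Real.exp_nat_mul]; ring_nf
        gcongr
    _ = _ := by rw [← Real.exp_add, ← Real.exp_add]; ring_nf

end OperatorNorm

/-! ### A lower bound for the tail from the central limit theorem. -/

section LowerTail

/-- The central limit theorem bounds the lower tail of a sum of centered coins from below. -/
theorem exists_le_measureReal_sum_centered_le {r : ℝ} (hr0 : 0 < r) (hr1 : r < 1) (t : ℝ) :
    ∃ κ : ℝ, 0 < κ ∧ κ ≤ 1 ∧ ∀ᶠ m : ℕ in atTop,
      κ ≤ (Measure.pi fun _ : Fin m => coin r).real {x | ∑ k, centered r (x k) ≤ -(t * √m)} := by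
  have hr : r ∈ Set.Icc (0 : ℝ) 1 := ⟨hr0.le, hr1.le⟩
  have := isProbabilityMeasure_coin hr
  -- The limit theorem needs one i.i.d. sequence on one space; the finite products are recovered at
  -- the end as marginals. The sign of `X` turns the lower tail into an upper one.
  let P := Measure.infinitePi fun _ : ℕ => coin r
  let X : ℕ → (ℕ → Bool) → ℝ := fun k ω => -centered r (ω k)
  have hXm : ∀ k, Measurable (X k) := fun k =>
    (Measurable.of_discrete (f := fun b : Bool => -centered r b)).comp (measurable_pi_apply k)
  have hmap : ∀ k, P.map (fun ω => ω k) = coin r := fun k =>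
    Measure.infinitePi_map_eval (fun _ : ℕ => coin r) k
  have hind0 : iIndepFun (fun (k : ℕ) (ω : ℕ → Bool) => ω k) P :=
    iIndepFun_infinitePi (X := fun _ x => x) fun _ => measurable_id
  have hind : iIndepFun X P := hind0.comp (fun _ b => -centered r b) fun _ => Measurable.of_discrete
  have hlaw : ∀ k, P.map (X k) = (coin r).map fun b => -centered r b := by
    intro k
    have h := Measure.map_map (μ := P) (f := fun ω : ℕ → Bool => ω k)
      (g := fun b : Bool => -centered r b) Measurable.of_discrete (measurable_pi_apply k)
    rw [hmap k] at h
    exact h.symm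
  have hident : ∀ k, IdentDistrib (X k) (X 0) P P := fun k =>
    ⟨(hXm k).aemeasurable, (hXm 0).aemeasurable, by rw [hlaw, hlaw]⟩
  have hint : ∀ f : Bool → ℝ, ∫ ω, f (ω 0) ∂P = r * f true + (1 - r) * f false := by
    intro f
    rw [← integral_coin hr, ← hmap 0]
    exact (integral_map (measurable_pi_apply 0).aemeasurable
      Measurable.of_discrete.aestronglyMeasurable).symm
  have hbdd : ∀ ω, ‖X 0 ω‖ ≤ 1 := by
    intro ω
    simp only [X, centered, norm_neg, Real.norm_eq_abs]
    split_ifs <;> rw [abs_le] <;> constructor <;> linarith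
  have hL2 : MemLp (X 0) 2 P := MemLp.of_bound (hXm 0).aestronglyMeasurable 1 (ae_of_all _ hbdd)
  have hmean : ∫ ω, X 0 ω ∂P = 0 := by
    rw [hint fun b => -centered r b]
    simp only [centered, if_true, Bool.false_eq_true, if_false]
    ring
  have hvar : Var[X 0; P] = r * (1 - r) := by
    rw [variance_of_integral_eq_zero (hXm 0).aemeasurable hmean]
    rw [hint fun b => (-centered r b) ^ 2]
    simp only [centered, if_true, Bool.false_eq_true, if_false]
    ring
  set v : NNReal := Var[X 0; P].toNNReal with hv
  have hv0 : v ≠ 0 := by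
    rw [hv, hvar, Ne, Real.toNNReal_eq_zero, not_le]
    exact mul_pos hr0 (by linarith)
  have hclt := tendstoInDistribution_inv_sqrt_mul_sum_sub (P' := gaussianReal 0 v) (Y := id)
    HasLaw.id hL2 hind hident
  -- Portmanteau for the open half-line: the liminf is at least its Gaussian mass, which is positive
  -- since the variance r(1-r) is, and half of that mass serves as κ.
  have hlim := ProbabilityMeasure.le_liminf_measure_open_of_tendsto hclt.tendsto
    (isOpen_Ioi (a := t))
  have hpos : 0 < (gaussianReal 0 v) (Set.Ioi t) := by
    rw [pos_iff_ne_zero]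
    intro h0
    have := gaussianReal_absolutelyContinuous' 0 hv0 h0
    simp at this
  have hpos' : 0 < (gaussianReal 0 v).real (Set.Ioi t) := 
    ENNReal.toReal_pos hpos.ne' (measure_ne_top _ _)
  refine ⟨(gaussianReal 0 v).real (Set.Ioi t) / 2, by positivity, ?_, ?_⟩
  · have : (gaussianReal 0 v).real (Set.Ioi t) ≤ 1 := measureReal_le_one
    linarith
  have hlt : ENNReal.ofReal ((gaussianReal 0 v).real (Set.Ioi t) / 2) <
      liminf (fun m : ℕ => (P.map fun ω => (√(m : ℝ))⁻¹ *
        (∑ k ∈ Finset.range m, X k ω - m * ∫ ω, X 0 ω ∂P)) (Set.Ioi t)) atTop := by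
    refine lt_of_lt_of_le ?_ (by simpa using hlim)
    rw [ENNReal.ofReal_lt_iff_lt_toReal (by positivity) (measure_ne_top _ _)]
    change _ < (gaussianReal 0 v).real (Set.Ioi t)
    linarith
  filter_upwards [eventually_lt_of_lt_liminf hlt, eventually_gt_atTop 0] with m hm hm0
  have hsq : 0 < √(m : ℝ) := Real.sqrt_pos.2 (by exact_mod_cast hm0)
  have hpi : P.map (fun ω (k : Fin m) => ω k) = Measure.pi fun _ : Fin m => coin r := by
    have := (hind0.precomp (g := fun k : Fin m => (k : ℕ)) Fin.val_injective).map_fun_eq_pi_map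
      fun k => (measurable_pi_apply _).aemeasurable
    rw [this]
    congr 1
    ext1 k
    exact hmap k
  rw [← hpi, map_measureReal_apply (by fun_prop) (MeasurableSet.of_discrete)]
  rw [Measure.map_apply (by fun_prop) measurableSet_Ioi] at hm
  have hm2 := (ENNReal.ofReal_lt_iff_lt_toReal (by positivity) (measure_ne_top _ _)).1 hm
  refine hm2.le.trans (measureReal_mono (fun ω hω => ?_) (measure_ne_top _ _))
  simp only [Set.mem_preimage, Set.mem_Ioi, hmean, mul_zero, sub_zero, Set.mem_ofPred_eq] at hω ⊢
  rw [← div_eq_inv_mul, lt_div_iff₀ hsq] at hω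
  rw [Finset.sum_range] at hω
  simp only [X, Finset.sum_neg_distrib] at hω
  linarith

end LowerTail

/-! ### Independence of functions of disjoint blocks of edges. -/

section Blocks

variable {κ : Type*} [Finite κ] {P : Measure (κ → Bool)}

/-- Each function factors through the restriction to its block: filling the other coordinates with
`false` does not change its value. -/
theorem indepFun_of_dependsOn (hP : iIndepFun (fun (e : κ) (ω : κ → Bool) => ω e) P)
    {β γ : Type*} [MeasurableSpace β] [MeasurableSpace γ] {S T : Finset κ} (hST : Disjoint S T)
    {f : (κ → Bool) → β} {g : (κ → Bool) → γ} (hf : DependsOn f S) (hg : DependsOn g T) :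
    IndepFun f g P := by
  classical
  have h := hP.indepFun_finset S T hST fun e => measurable_pi_apply e
  let ext : ∀ U : Finset κ, (U → Bool) → κ → Bool := fun U y e =>
    if he : e ∈ U then y ⟨e, he⟩ else false
  have hext : ∀ (U : Finset κ) (ω : κ → Bool), ∀ e ∈ (U : Set κ),
      ω e = ext U (fun a : U => ω a) e := by
    intro U ω e he
    simp [ext, Finset.mem_coe.1 he]
  have h1 : f = (fun y => f (ext S y)) ∘ fun ω (a : S) => ω a :=
    funext fun ω => hf (hext S ω)
  have h2 : g = (fun y => g (ext T y)) ∘ fun ω (a : T) => ω a :=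
    funext fun ω => hg (hext T ω)
  rw [h1, h2]
  exact h.comp Measurable.of_discrete Measurable.of_discrete

theorem iIndepFun_of_dependsOn [IsProbabilityMeasure P]
    (hP : iIndepFun (fun (e : κ) (ω : κ → Bool) => ω e) P)
    {ι β : Type*} [MeasurableSpace β] {T : ι → Finset κ}
    (hT : Pairwise fun i j => Disjoint (T i) (T j))
    {F : ι → (κ → Bool) → β} (hF : ∀ i, DependsOn (F i) (T i)) : iIndepFun F P := by
  classical
  rw [iIndepFun_iff_measure_inter_preimage_eq_mul]
  intro S sets hsets
  induction S using Finset.induction_on with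
  | empty => simp
  | insert a S ha ih =>
    rw [Finset.prod_insert ha, Finset.set_biInter_insert,
      ← ih fun i hi => hsets i (Finset.mem_insert_of_mem hi)]
    -- In the induction, the intersection of the events of `S` is one proposition determined by the
    -- union of their blocks, which is disjoint from the block of `a`.
    have hdep : DependsOn (fun ω => ∀ i ∈ S, F i ω ∈ sets i) (S.biUnion T : Finset κ) := by
      intro ω ω' h
      have : ∀ i ∈ S, F i ω = F i ω' := fun i hi => hF i fun e he => h e (by
        simp only [Finset.coe_biUnion, Set.mem_iUnion]
        exact ⟨i, hi, he⟩)
      simp only [eq_iff_iff]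
      exact forall₂_congr fun i hi => by rw [this i hi]
    have hdisj : Disjoint (T a) (S.biUnion T) := by
      rw [Finset.disjoint_biUnion_right]
      intro i hi
      exact hT (by rintro rfl; exact ha hi)
    have := (indepFun_of_dependsOn hP hdisj (hF a) hdep).measure_inter_preimage_eq_mul (sets a)
      {True} (hsets a (Finset.mem_insert_self _ _)) (by measurability)
    have hset : (fun ω => ∀ i ∈ S, F i ω ∈ sets i) ⁻¹' {True} = ⋂ i ∈ S, F i ⁻¹' sets i := by
      ext ω
      simp
    rwa [hset] at this

/-- Hoeffding's inequality for the number of independent events that occur. -/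
theorem measureReal_card_filter_le {Ω ι : Type*} [MeasurableSpace Ω]
    [DiscreteMeasurableSpace Ω] {P : Measure Ω} [IsProbabilityMeasure P]
    {E : ι → Ω → Prop} [∀ i ω, Decidable (E i ω)]
    (hE : iIndepFun E P) {c : ℝ} (hc : 0 ≤ c) (S : Finset ι)
    (hprob : ∀ i ∈ S, c ≤ P.real {ω | E i ω}) :
    P.real {ω | ((S.filter fun i => E i ω).card : ℝ) ≤ c / 2 * S.card} ≤
      Real.exp (-(c ^ 2 / 2 * S.card)) := by
  classical
  let X : ι → Ω → ℝ := fun i ω => if E i ω then 1 else 0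
  have hmean : ∀ i, ∫ ω, X i ω ∂P = P.real {ω | E i ω} := by
    intro i
    have : X i = Set.indicator {ω | E i ω} 1 := by
      ext ω
      by_cases h : E i ω <;> simp [X, h]
    rw [this, integral_indicator_one MeasurableSet.of_discrete]
  have hsub : ∀ i, HasSubgaussianMGF (fun ω => -(X i ω - ∫ ω, X i ω ∂P)) (1 / 4) P := by
    intro i
    have h := (hasSubgaussianMGF_of_mem_Icc (μ := P) (a := 0) (b := 1) (X := X i)
      Measurable.of_discrete.aemeasurable
      (ae_of_all _ fun ω => by simp only [X]; split_ifs <;> simp)).neg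
    convert! h using 1
    ext
    norm_num
  have hind : iIndepFun (fun i ω => -(X i ω - ∫ ω, X i ω ∂P)) P := by
    have h := hE.comp (fun i a => -((if a then 1 else 0) - ∫ ω, X i ω ∂P))
      fun _ => Measurable.of_discrete
    have h2 : (fun i ω => -(X i ω - ∫ ω, X i ω ∂P)) =
        fun i => (fun a : Prop => -((if a then (1 : ℝ) else 0) - ∫ ω, X i ω ∂P)) ∘ E i := by
      ext i ω
      by_cases h : E i ω <;> simp [X, h]
    rwa [h2]
  have h := HasSubgaussianMGF.measure_sum_ge_le_of_iIndepFun hind (s := S) (fun i _ => hsub i)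
    (ε := c / 2 * S.card) (by positivity)
  refine (measureReal_mono (fun ω hω => ?_) (measure_ne_top _ _)).trans
    (h.trans (Real.exp_le_exp.2 ?_))
  · simp only [Set.mem_ofPred_eq, Finset.sum_neg_distrib, Finset.sum_sub_distrib] at hω ⊢
    have h1 : ∑ i ∈ S, X i ω = ((S.filter fun i => E i ω).card : ℝ) := by
      simp [X]
    have h2 : c * S.card ≤ ∑ i ∈ S, ∫ ω, X i ω ∂P := by
      calc c * S.card = ∑ _i ∈ S, c := by simp [mul_comm]
        _ ≤ _ := Finset.sum_le_sum fun i hi => by rw [hmean]; exact hprob i hi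
    rw [h1]
    linarith
  · rcases S.eq_empty_or_nonempty with rfl | hS
    · simp
    · have : (0 : ℝ) < S.card := by exact_mod_cast hS.card_pos
      apply le_of_eq
      rw [Finset.sum_const, nsmul_eq_mul]
      push_cast
      field_simp
      norm_num

end Blocks

/-! ### Conditioning on a discrete variable. -/

section Conditioning

theorem measureReal_inter_of_dependsOn {κ : Type*} [Finite κ] {P : Measure (κ → Bool)}
    (hP : iIndepFun (fun (e : κ) (ω : κ → Bool) => ω e) P) {S T : Finset κ} (hST : Disjoint S T)
    {A B : (κ → Bool) → Prop} (hA : DependsOn A S) (hB : DependsOn B T) :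
    P.real {ω | A ω ∧ B ω} = P.real {ω | A ω} * P.real {ω | B ω} := by
  have h := (indepFun_of_dependsOn hP hST hA hB).measure_inter_preimage_eq_mul {True} {True}
    (by measurability) (by measurability)
  have h1 : ∀ F : (κ → Bool) → Prop, F ⁻¹' {True} = {ω | F ω} := by
    intro F; ext; simp
  rw [h1, h1] at h
  simp only [measureReal_def, ← ENNReal.toReal_mul, ← h]
  rfl

/-- The law of total probability over the values of `S`; the product form of the hypothesis avoids
conditioning on null fibers. -/
theorem measureReal_le_of_forall_fiber_le {Ω ι : Type*} [MeasurableSpace Ω]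
    [DiscreteMeasurableSpace Ω] [Fintype ι] {P : Measure Ω} [IsProbabilityMeasure P] (S : Ω → ι)
    (B : ι → Ω → Prop) {δ : ℝ}
    (h : ∀ U, P.real {ω | S ω = U ∧ B U ω} ≤ P.real {ω | S ω = U} * δ) :
    P.real {ω | B (S ω) ω} ≤ δ := by
  have h1 : {ω | B (S ω) ω} ⊆ ⋃ U ∈ (Finset.univ : Finset ι), {ω | S ω = U ∧ B U ω} := by
    intro ω hω
    simp only [Set.mem_iUnion]
    exact ⟨S ω, Finset.mem_univ _, rfl, hω⟩
  have h2 : ∑ U, P.real {ω | S ω = U} = 1 := by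
    have h3 := measureReal_biUnion_finset (μ := P) (s := (Finset.univ : Finset ι))
      (f := fun U => {ω | S ω = U})
      (fun U _ V _ hUV => Set.disjoint_left.2 fun ω h1 h2 => hUV (h1.symm.trans h2))
      (fun _ _ => MeasurableSet.of_discrete)
    rw [← h3, ← probReal_univ (μ := P)]
    congr 1
    ext ω
    simp
  calc _ ≤ _ := measureReal_mono h1 (measure_ne_top _ _)
    _ ≤ ∑ U, _ := measureReal_biUnion_finset_le _ _
    _ ≤ ∑ U, P.real {ω | S ω = U} * δ := Finset.sum_le_sum fun U _ => h U
    _ = δ := by rw [← Finset.sum_mul, h2, one_mul]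

end Conditioning

/-! ### Inner and cross parts of the noise at a vertex. -/

section ClusterDegrees

variable {n : ℕ} {p q : ℝ}

/-- The pair formed by two different vertices. -/
def edgeOf (i j : Fin n) (h : i ≠ j) : VertexPair n :=
  if h' : i < j then ⟨(i, j), h'⟩ else ⟨(j, i), lt_of_le_of_ne (not_lt.1 h') h.symm⟩

theorem edgeOf_val (i j : Fin n) (h : i ≠ j) :
    (edgeOf i j h).1 = (i, j) ∨ (edgeOf i j h).1 = (j, i) := by
  unfold edgeOf
  split_ifs <;> simp

theorem noiseMatrix_graphOf (ω : VertexPair n → Bool) (i j : Fin n) (h : i ≠ j) :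
    noiseMatrix p q (graphOf ω) i j = edgeNoise p q (edgeOf i j h) ω := by
  unfold edgeOf
  split_ifs with h'
  · exact noiseMatrix_graphOf_of_lt ω h'
  · rw [noiseMatrix_comm]
    exact noiseMatrix_graphOf_of_lt ω _

theorem noiseMatrix_graphOf_congr {ω ω' : VertexPair n → Bool} (i j : Fin n)
    (h : ∀ e : VertexPair n, e.1 = (i, j) ∨ e.1 = (j, i) → ω e = ω' e) :
    noiseMatrix p q (graphOf ω) i j = noiseMatrix p q (graphOf ω') i j := by
  rcases eq_or_ne i j with rfl | hij
  · rw [noiseMatrix_self, noiseMatrix_self]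
  · rw [noiseMatrix_graphOf _ _ _ hij, noiseMatrix_graphOf _ _ _ hij, edgeNoise, edgeNoise,
      h _ (edgeOf_val i j hij)]

/-- The centered number of neighbors of `j` in the cluster of sign `s`. -/
def innerNoise (p q s : ℝ) (j : Fin n) (ω : VertexPair n → Bool) : ℝ :=
  ∑ i : Fin n, if clusterSign i = s then noiseMatrix p q (graphOf ω) j i else 0

/-- Minus the centered number of neighbors of `j` outside of the cluster of sign `s`. -/
def crossNoise (p q s : ℝ) (j : Fin n) (ω : VertexPair n → Bool) : ℝ :=
  -∑ i : Fin n, if clusterSign i = s then 0 else noiseMatrix p q (graphOf ω) j i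

theorem clusterSign_mul_mulVec (ω : VertexPair n → Bool) (j : Fin n) :
    clusterSign j * (noiseMatrix p q (graphOf ω)).mulVec clusterSign j =
      innerNoise p q (clusterSign j) j ω + crossNoise p q (clusterSign j) j ω := by
  unfold innerNoise crossNoise
  rw [← Finset.sum_neg_distrib, ← Finset.sum_add_distrib, Matrix.mulVec, dotProduct,
    Finset.mul_sum]
  refine Finset.sum_congr rfl fun i _ => ?_
  rcases clusterSign_eq i with h | h <;> rcases clusterSign_eq j with h' | h' <;>
    rw [h, h'] <;> norm_num

/-- The pairs inside of the cluster of sign `s`. -/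
def innerEdges (n : ℕ) (s : ℝ) : Finset (VertexPair n) :=
  Finset.univ.filter fun e => clusterSign e.1.1 = s ∧ clusterSign e.1.2 = s

/-- The pairs that join the vertex `j` of the cluster of sign `s` to the other cluster. -/
def crossEdges (s : ℝ) (j : Fin n) : Finset (VertexPair n) :=
  Finset.univ.filter fun e => clusterSign j = s ∧
    ((e.1.1 = j ∧ clusterSign e.1.2 ≠ s) ∨ (e.1.2 = j ∧ clusterSign e.1.1 ≠ s))

/-- A pair across the clusters has only one endpoint in the cluster of sign `s`; for `j` outside
that cluster `crossEdges` is empty, so no restriction on the vertices is needed. -/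
theorem disjoint_crossEdges (s : ℝ) :
    Pairwise fun i j : Fin n => Disjoint (crossEdges s i) (crossEdges s j) := by
  intro i j hij
  rw [Finset.disjoint_left]
  intro e he he'
  simp only [crossEdges, Finset.mem_filter, Finset.mem_univ, true_and] at he he'
  obtain ⟨hi, ⟨h1, h2⟩ | ⟨h1, h2⟩⟩ := he <;> obtain ⟨hj, ⟨h3, h4⟩ | ⟨h3, h4⟩⟩ := he'
  · exact hij (h1.symm.trans h3)
  · exact h4 (by rw [h1, hi])
  · exact h2 (by rw [h3, hj])
  · exact hij (h1.symm.trans h3)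

theorem disjoint_innerEdges_crossEdges (s : ℝ) (j : Fin n) :
    Disjoint (innerEdges n s) (crossEdges s j) := by
  rw [Finset.disjoint_left]
  intro e he he'
  simp only [crossEdges, innerEdges, Finset.mem_filter, Finset.mem_univ, true_and] at he he'
  tauto

theorem dependsOn_innerNoise (s : ℝ) {j : Fin n} (hj : clusterSign j = s) :
    DependsOn (innerNoise p q s j) (innerEdges n s : Set (VertexPair n)) := by
  intro ω ω' h
  refine Finset.sum_congr rfl fun i _ => ?_
  split_ifs with hi
  · refine noiseMatrix_graphOf_congr _ _ fun e he => h e ?_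
    rcases he with he | he <;> simp [innerEdges, he, hi, hj]
  · rfl

theorem dependsOn_crossNoise (s : ℝ) {j : Fin n} (hj : clusterSign j = s) :
    DependsOn (crossNoise p q s j) (crossEdges s j : Set (VertexPair n)) := by
  intro ω ω' h
  refine congrArg Neg.neg (Finset.sum_congr rfl fun i _ => ?_)
  split_ifs with hi
  · rfl
  · refine noiseMatrix_graphOf_congr _ _ fun e he => h e ?_
    rcases he with he | he <;> simp [crossEdges, he, hi, hj]

theorem card_clusterSign_eq {m : ℕ} (hn : n = 2 * m) {s : ℝ} (hs : s = 1 ∨ s = -1) :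
    (Finset.univ.filter fun i : Fin n => clusterSign i = s).card = m ∧
      Fintype.card {i : Fin n // ¬ clusterSign i = s} = m := by
  rw [Fintype.card_subtype]
  have h1 := Finset.card_filter_add_card_filter_not (s := (Finset.univ : Finset (Fin n)))
    (fun i => clusterSign i = s)
  rw [Finset.card_univ, Fintype.card_fin] at h1
  have h2 := sum_clusterSign (n := n) (hn ▸ even_two_mul m)
  rw [← Finset.sum_filter_add_sum_filter_not _ (fun i : Fin n => clusterSign i = s)] at h2
  rw [Finset.sum_congr rfl (g := fun _ => s) fun i hi => (Finset.mem_filter.1 hi).2,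
    Finset.sum_congr rfl (s₁ := Finset.univ.filter fun i : Fin n => ¬ clusterSign i = s)
      (g := fun _ => -s) fun i hi => by
        have := (Finset.mem_filter.1 hi).2
        rcases hs with rfl | rfl <;> rcases clusterSign_eq i with h | h <;> simp_all] at h2
  simp only [Finset.sum_const, nsmul_eq_mul] at h2
  have h3 : ((Finset.univ.filter fun i : Fin n => clusterSign i = s).card : ℝ) =
      (Finset.univ.filter fun i : Fin n => ¬ clusterSign i = s).card := by
    rcases hs with rfl | rfl <;> linarith
  have h4 := Nat.cast_injective h3
  omega

/-- The cross pairs at `j` are m distinct coins of bias q; `crossNoise` carries a minus sign, hence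
the reversed tail. -/
theorem measureReal_crossNoise_ge (hp : p ∈ Set.Icc (0 : ℝ) 1) (hq : q ∈ Set.Icc (0 : ℝ) 1)
    {m : ℕ} (hn : n = 2 * m) {s : ℝ} (hs : s = 1 ∨ s = -1) {j : Fin n} (hj : clusterSign j = s)
    (t : ℝ) :
    (edgeLaw n p q).real {ω | t ≤ crossNoise p q s j ω} =
      (Measure.pi fun _ : Fin m => coin q).real {x | ∑ k, centered q (x k) ≤ -t} := by
  classical
  have := isProbabilityMeasure_edgeLaw (n := n) hp hq
  let φ : Fin m ≃ {i : Fin n // ¬ clusterSign i = s} :=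
    (Fintype.equivFinOfCardEq (card_clusterSign_eq hn hs).2).symm
  have hne : ∀ i : {i : Fin n // ¬ clusterSign i = s}, j ≠ i := fun i h => i.2 (h ▸ hj)
  let g : Fin m → VertexPair n := fun k => edgeOf j (φ k) (hne _)
  have hg : Function.Injective g := by
    intro k l hkl
    have h1 := edgeOf_val j (φ k) (hne _)
    have h2 := edgeOf_val j (φ l) (hne _)
    have h3 : (edgeOf j (φ k) (hne _)).1 = (edgeOf j (φ l) (hne _)).1 := congrArg Subtype.val hkl
    apply φ.injective
    apply Subtype.ext
    have h4 := hne (φ k)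
    have h5 := hne (φ l)
    rcases h1 with h1 | h1 <;> rcases h2 with h2 | h2 <;> rw [h1, h2, Prod.mk.injEq] at h3
    · exact h3.2
    · exact absurd h3.1 h5
    · exact absurd h3.1.symm h4
    · exact h3.1
  have hprob : ∀ k, edgeProb p q (g k) = q := by
    intro k
    have h1 := clusterSign_mul j (φ k).1
    have h2 := (φ k).2
    have h3 : ¬ SameCluster j (φ k).1 := by
      intro h
      rw [if_pos h] at h1
      rcases hs with rfl | rfl <;> rcases clusterSign_eq (φ k).1 with h' | h' <;>
        rw [hj, h'] at h1 <;> norm_num at h1 <;> exact h2 h'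
    have h4 : ¬ SameCluster (φ k).1 j := fun h => h3 h.symm
    unfold edgeProb
    rcases edgeOf_val j (φ k) (hne _) with h | h
    · simp only [g, h, h3, if_false]
    · simp only [g, h, h4, if_false]
  have hmap : (edgeLaw n p q).map (fun ω k => ω (g k)) = Measure.pi fun _ : Fin m => coin q := by
    rw [((iIndepFun_eval_edgeLaw hp hq).precomp hg).map_fun_eq_pi_map
      fun k => (measurable_pi_apply _).aemeasurable]
    congr 1
    ext1 k
    rw [map_eval_edgeLaw hp hq, hprob]
  rw [← hmap, map_measureReal_apply Measurable.of_discrete MeasurableSet.of_discrete]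
  congr 1
  ext ω
  have h : ∑ i : Fin n, (if clusterSign i = s then 0 else noiseMatrix p q (graphOf ω) j i) =
      ∑ k, centered q (ω (g k)) := by
    have h1 : ∀ i : Fin n, (if clusterSign i = s then 0 else noiseMatrix p q (graphOf ω) j i) =
        if ¬ clusterSign i = s then noiseMatrix p q (graphOf ω) j i else 0 := by
      intro i; rw [ite_not]
    rw [Finset.sum_congr rfl fun i _ => h1 i, ← Finset.sum_filter,
      Finset.sum_subtype (p := fun i => ¬ clusterSign i = s) _ (by simp), ← φ.sum_comp]
    refine Finset.sum_congr rfl fun k _ => ?_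
    rw [noiseMatrix_graphOf _ _ _ (hne (φ k)), edgeNoise]
    change centered (edgeProb p q (g k)) (ω (g k)) = _
    rw [hprob]
  simp only [Set.mem_ofPred_eq, Set.mem_preimage, crossNoise, h]
  constructor <;> intro h <;> linarith

end ClusterDegrees

/-! ### Linearly many strongly attached vertices. -/

section AttachedVertices

variable {n : ℕ} {p q : ℝ}

open Classical in
/-- The vertices of a cluster whose centered number of neighbors in this cluster is at least `-a`. -/
def innerTypical (p q s a : ℝ) (ω : VertexPair n → Bool) : Finset (Fin n) :=
  Finset.univ.filter fun j => clusterSign j = s ∧ -a ≤ innerNoise p q s j ω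

-- W applied to the indicator of the cluster has the inner noises as its entries on that cluster.
-- Its squared norm is at most K²nm, so at most m/4 of them fall below -2K√n.
open Classical in
theorem card_innerTypical_ge {m : ℕ} (hn : n = 2 * m) {s K : ℝ} (hs : s = 1 ∨ s = -1)
    (hK : 0 < K) {ω : VertexPair n → Bool}
    (hW : NormBound (noiseMatrix p q (graphOf ω)) (K * √n)) :
    3 / 4 * (m : ℝ) ≤ (innerTypical p q s (2 * K * √n) ω).card := by
  rcases Nat.eq_zero_or_pos m with rfl | hm
  · simp
  have hm0 : (0 : ℝ) < m := by exact_mod_cast hm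
  have hnm : (n : ℝ) = 2 * m := by rw [hn]; push_cast; ring
  have hsq : √(n : ℝ) ^ 2 = n := Real.sq_sqrt (by positivity)
  let x : Fin n → ℝ := fun i => if clusterSign i = s then 1 else 0
  have hx : x ⬝ᵥ x = m := by
    have h : x ⬝ᵥ x = ((Finset.univ.filter fun i : Fin n => clusterSign i = s).card : ℝ) := by
      simp [dotProduct, x, ← ite_and]
    rw [h, (card_clusterSign_eq hn hs).1]
  have hWx : ∀ j, (noiseMatrix p q (graphOf ω)).mulVec x j = innerNoise p q s j ω := by
    intro j
    simp [Matrix.mulVec, dotProduct, x, innerNoise]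
  set B := Finset.univ.filter fun j : Fin n =>
    clusterSign j = s ∧ ¬ (-(2 * K * √n) ≤ innerNoise p q s j ω) with hB
  have h1 := card_filter_abs_ge_mul_sq_le ((noiseMatrix p q (graphOf ω)).mulVec x)
    (t := 2 * K * √n) (by positivity) B (by
      intro j hj
      have hj := (Finset.mem_filter.1 hj).2.2
      rw [hWx]
      exact le_trans (by linarith) (neg_le_abs _))
  have h2 := h1.trans (hW.2 x)
  rw [hx, mul_pow, mul_pow, mul_pow, hsq, hnm] at h2
  have h3 : (B.card : ℝ) ≤ m / 4 := by
    have h4 : 0 < K ^ 2 * (8 * m) := by positivity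
    refine le_of_mul_le_mul_right (h2.trans' (le_of_eq ?_) |>.trans (le_of_eq ?_)) h4 <;> ring
  have h5 : (innerTypical p q s (2 * K * √n) ω).card + B.card = m := by
    rw [← (card_clusterSign_eq hn hs).1, innerTypical, hB, ← Finset.filter_filter,
      ← Finset.filter_filter]
    exact Finset.card_filter_add_card_filter_not _
  have h6 : ((innerTypical p q s (2 * K * √n) ω).card : ℝ) + B.card = m := by exact_mod_cast h5
  linarith

open Classical in
/-- Given that the noise has small operator norm, a positive proportion of the vertices of each
cluster is strongly attached, except with exponentially small probability. -/
theorem measureReal_few_attached_le (hp : p ∈ Set.Icc (0 : ℝ) 1) (hq : q ∈ Set.Icc (0 : ℝ) 1)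
    {m : ℕ} (hm : 0 < m) (hn : n = 2 * m) {s K η κ : ℝ} (hs : s = 1 ∨ s = -1) (hK : 0 < K)
    (hη : 0 ≤ η) (hκ : 0 < κ)
    (htail : κ ≤ (Measure.pi fun _ : Fin m => coin q).real
      {x | ∑ k, centered q (x k) ≤ -(2 * (η + 2 * K + 1) * √m)}) :
    (edgeLaw n p q).real {ω | NormBound (noiseMatrix p q (graphOf ω)) (K * √n) ∧
      ((Finset.univ.filter fun j : Fin n => clusterSign j = s ∧
        (p - q) * n / 2 + η * √n ≤ attachment (graphOf ω) j).card : ℝ) ≤ 3 / 16 * κ * n} ≤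
      Real.exp (-(3 / 16 * κ ^ 2 * n)) := by
  have := isProbabilityMeasure_edgeLaw (n := n) hp hq
  have hm0 : (1 : ℝ) ≤ m := by exact_mod_cast hm
  have hnm : (n : ℝ) = 2 * m := by rw [hn]; push_cast; ring
  have hsqn : 1 ≤ √(n : ℝ) := Real.one_le_sqrt.2 (by linarith)
  have hsqm : √(n : ℝ) ≤ 2 * √m := by
    rw [hnm]
    refine Real.sqrt_le_iff.2 ⟨by positivity, ?_⟩
    rw [mul_pow, Real.sq_sqrt (by positivity)]
    linarith
  set t := 2 * (η + 2 * K + 1) * √(m : ℝ) with ht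
  let E : Fin n → (VertexPair n → Bool) → Prop := fun j ω =>
    clusterSign j = s ∧ t ≤ crossNoise p q s j ω
  have hEdep : ∀ j, DependsOn (E j) (crossEdges s j : Set (VertexPair n)) := by
    intro j ω ω' h
    simp only [E, eq_iff_iff]
    exact and_congr_right fun hj => by rw [dependsOn_crossNoise s hj h]
  have hind := iIndepFun_eval_edgeLaw (n := n) hp hq
  have hEind : iIndepFun E (edgeLaw n p q) :=
    iIndepFun_of_dependsOn hind (disjoint_crossEdges s) hEdep
  let T : (VertexPair n → Bool) → Finset (Fin n) := innerTypical p q s (2 * K * √n)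
  have hTdep : DependsOn T (innerEdges n s : Set (VertexPair n)) := by
    intro ω ω' h
    refine Finset.filter_congr fun j _ => and_congr_right fun hj => ?_
    rw [dependsOn_innerNoise s hj h]
  -- For a fixed value `U` of `T`, the event `B U` is determined by cross edges only, whereas `T` is
  -- determined by inner edges; so each fiber has product form.
  let B : Finset (Fin n) → (VertexPair n → Bool) → Prop := fun U ω =>
    3 / 4 * (m : ℝ) ≤ U.card ∧ ((U.filter fun j => E j ω).card : ℝ) ≤ κ / 2 * U.card
  have hmain : (edgeLaw n p q).real {ω | B (T ω) ω} ≤ Real.exp (-(3 / 16 * κ ^ 2 * n)) := by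
    refine measureReal_le_of_forall_fiber_le T B fun U => ?_
    by_cases hU : (∀ j ∈ U, clusterSign j = s) ∧ 3 / 4 * (m : ℝ) ≤ U.card
    swap
    · have : {ω | T ω = U ∧ B U ω} = ∅ := by
        rw [Set.eq_empty_iff_forall_notMem]
        rintro ω ⟨h1, h2⟩
        exact hU ⟨fun j hj => by rw [← h1] at hj; exact (Finset.mem_filter.1 hj).2.1, h2.1⟩
      rw [this, measureReal_empty]
      positivity
    · have hBdep : DependsOn (B U) (U.biUnion (crossEdges s) : Finset (VertexPair n)) := by
        intro ω ω' h
        have h1 : (U.filter fun j => E j ω) = U.filter fun j => E j ω' :=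
          Finset.filter_congr fun j hj => by
            rw [hEdep j fun e he => h e (by
              simp only [Finset.coe_biUnion, Set.mem_iUnion]; exact ⟨j, hj, he⟩)]
        simp only [B, h1]
      have hdisj : Disjoint (innerEdges n s) (U.biUnion (crossEdges s)) :=
        (Finset.disjoint_biUnion_right _ _ _).2 fun j _ => disjoint_innerEdges_crossEdges s j
      rw [measureReal_inter_of_dependsOn hind hdisj (A := fun ω => T ω = U)
        (fun ω ω' h => congrArg (· = U) (hTdep h)) hBdep]
      refine mul_le_mul_of_nonneg_left ?_ measureReal_nonneg
      have h1 := measureReal_card_filter_le hEind hκ.le U fun j hj => by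
        have : {ω | E j ω} = {ω | t ≤ crossNoise p q s j ω} := by
          ext ω; simp [E, hU.1 j hj]
        rw [this, measureReal_crossNoise_ge hp hq hn hs (hU.1 j hj)]
        exact htail
      refine (measureReal_mono (fun ω hω => hω.2) (measure_ne_top _ _)).trans
        (h1.trans (Real.exp_le_exp.2 ?_))
      rw [hnm]
      nlinarith [mul_le_mul_of_nonneg_left hU.2 (by positivity : 0 ≤ κ ^ 2 / 2)]
  refine (measureReal_mono (fun ω hω => ?_) (measure_ne_top _ _)).trans hmain
  obtain ⟨hW, hfew⟩ := hω
  have hcard : 3 / 4 * (m : ℝ) ≤ (T ω).card := card_innerTypical_ge hn hs hK hW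
  refine ⟨hcard, ?_⟩
  have hsub : ((T ω).filter fun j => E j ω) ⊆ Finset.univ.filter fun j : Fin n =>
      clusterSign j = s ∧ (p - q) * n / 2 + η * √n ≤ attachment (graphOf ω) j := by
    intro j hj
    obtain ⟨h1, h2, h3⟩ := Finset.mem_filter.1 hj
    have h4 := (Finset.mem_filter.1 h1).2.2
    refine Finset.mem_filter.2 ⟨Finset.mem_univ _, h2, ?_⟩
    have h5 := attachment_add_eq (hn ▸ even_two_mul m) p q (graphOf ω) j
    rw [clusterSign_mul_mulVec, h2] at h5
    -- Of this gain 2K√n pays for the inner noise and one √n ≥ 1 for the diagonal term p, leaving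
    -- η√n.
    have h6 : (η + 2 * K + 1) * √n ≤ t := by
      rw [ht]
      nlinarith [mul_le_mul_of_nonneg_left hsqm (by positivity : 0 ≤ η + 2 * K + 1)]
    have hp1 := hp.2
    linarith
  have h7 : (((T ω).filter fun j => E j ω).card : ℝ) ≤ _ :=
    Nat.cast_le.2 (Finset.card_le_card hsub)
  refine (h7.trans hfew).trans ?_
  rw [hnm]
  nlinarith [mul_le_mul_of_nonneg_left hcard (by positivity : 0 ≤ κ / 2)]

end AttachedVertices

/-! ### Union bound over the bad events and choice of constants. -/

theorem sbm_real_apply (n : ℕ) (p q : ℝ) (A : Set (SimpleGraph (Fin n))) :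
    (sbm n p q).real A = (edgeLaw n p q).real {ω | graphOf ω ∈ A} := by
  have hA : MeasurableSet A := by
    -- There are finitely many graphs, and each singleton is the preimage of a point under the
    -- adjacency relation.
    have : A = ⋃ G ∈ A, SimpleGraph.Adj ⁻¹' {G.Adj} := by
      ext H
      simp only [Set.mem_iUnion, Set.mem_preimage, Set.mem_singleton_iff, exists_prop]
      exact ⟨fun h => ⟨H, h, rfl⟩, fun ⟨G, hG, h⟩ => (SimpleGraph.ext h : H = G) ▸ hG⟩
    rw [this]
    exact (Set.toFinite A).measurableSet_biUnion fun G _ =>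
      SimpleGraph.measurable_adj (measurableSet_singleton _)
  exact map_measureReal_apply (measurable_graphOf n) hA

-- With K = 12 and the margin η + 3 of the comparison vertices, the tail level is 2((η+3) + 2·12 +
-- 1) = 2(η + 28). With ε = κ/16, the set size plus the exceptions stays below the 3κn/16 attached
-- vertices of each cluster.
open Classical in
theorem measureReal_not_extremesAttached_le {n m : ℕ} (hm : 0 < m) (hn : n = 2 * m)
    {p q η κ : ℝ} (hq : 0 < q) (hqp : q < p) (hp : p < 1) (hη : 0 ≤ η) (hκ : 0 < κ)
    (htail : κ ≤ (Measure.pi fun _ : Fin m => coin q).real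
      {x | ∑ k, centered q (x k) ≤ -(2 * (η + 28) * √m)})
    (h1 : 12 * √n ≤ (p - q) / 4 * n) (h2 : 12 * √n ≤ q / 2 * n)
    (h3 : 8 * 12 ^ 2 * (1 / q ^ 2 + 1 / ((p - q) / 2) ^ 2) ≤ (n : ℝ)) (h4 : p ≤ (p - q) / 4 * n)
    (h5 : 100 * exceptionBound p q 12 + 1 ≤ κ / 16 * n) :
    (sbm n p q).real {G | ¬ ExtremesAttached p q η (κ / 16) G} ≤
      Real.exp (-n) + 2 * Real.exp (-(3 / 16 * κ ^ 2 * n)) := by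
  have hp' : p ∈ Set.Icc (0 : ℝ) 1 := ⟨by linarith, hp.le⟩
  have hq' : q ∈ Set.Icc (0 : ℝ) 1 := ⟨hq.le, by linarith⟩
  have := isProbabilityMeasure_edgeLaw (n := n) hp' hq'
  have hexc : 0 ≤ exceptionBound p q 12 := by unfold exceptionBound; positivity
  let F : ℝ → Set (VertexPair n → Bool) := fun s =>
    {ω | NormBound (noiseMatrix p q (graphOf ω)) (12 * √n) ∧
      ((Finset.univ.filter fun j : Fin n => clusterSign j = s ∧
        (p - q) * n / 2 + (η + 3) * √n ≤ attachment (graphOf ω) j).card : ℝ) ≤ 3 / 16 * κ * n}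
  have hF : ∀ s, s = 1 ∨ s = -1 →
      (edgeLaw n p q).real (F s) ≤ Real.exp (-(3 / 16 * κ ^ 2 * n)) := fun s hs =>
    measureReal_few_attached_le hp' hq' hm hn hs (by norm_num) (by linarith) hκ
      (by convert htail using 7; ring)
  rw [sbm_real_apply]
  have hsub : {ω | graphOf ω ∈ {G : SimpleGraph (Fin n) | ¬ ExtremesAttached p q η (κ / 16) G}} ⊆
      {ω | ¬ NormBound (noiseMatrix p q (graphOf ω)) (12 * √n)} ∪ (F 1 ∪ F (-1)) := by
    intro ω hω
    by_contra hcon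
    simp only [Set.mem_union, not_or, Set.mem_ofPred_eq, not_not] at hcon
    obtain ⟨hW, hF1, hF2⟩ := hcon
    refine hω fun v hv S hS => ?_
    have hfloor := Nat.lt_floor_add_one (κ / 16 * (n : ℝ))
    have hfloor2 := Nat.floor_le (by positivity : 0 ≤ κ / 16 * (n : ℝ))
    -- The `+ 1` in `h5` absorbs the loss from the floor.
    refine mostlyAttached_of_normBound (hn ▸ even_two_mul m) (by omega) hq hqp hη hW h1 h2 h3 h4
      (k := ⌊κ / 16 * (n : ℝ)⌋₊) (by linarith) (fun s hs => ?_) hv hS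
    have hFs : ω ∉ F s := by rcases hs with rfl | rfl <;> assumption
    have := not_le.1 fun h => hFs ⟨hW, h⟩
    linarith
  calc _ ≤ _ := measureReal_mono hsub (measure_ne_top _ _)
    _ ≤ _ := (measureReal_union_le _ _).trans
      (add_le_add (measureReal_not_normBound_le hp' hq') (measureReal_union_le _ _))
    _ ≤ _ := by linarith [hF 1 (Or.inl rfl), hF (-1) (Or.inr rfl)]

end StochasticBlock

end

theorem corollary1 (p q : ℝ) (hq : 0 < q) (hqp : q < p) (hp : p < 1) (η : ℝ) (hη : 0 < η) :
    ∃ ε : ℝ, 0 < ε ∧ ε < 1 ∧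
      ∃ C c : ℝ, 0 < C ∧ 0 < c ∧ ∀ n : ℕ, 2 ≤ n → Even n →
        (StochasticBlock.sbm n p q).real
            {G | ¬ StochasticBlock.ExtremesAttached p q η ε G} ≤
          C * Real.exp (-c * (n : ℝ)) := by
  open StochasticBlock Filter in
  obtain ⟨κ, hκ0, hκ1, htail⟩ :=
    exists_le_measureReal_sum_centered_le hq (hqp.trans hp) (2 * (η + 28))
  obtain ⟨M, hM⟩ := eventually_atTop.1 htail
  have hnat : Tendsto (fun n : ℕ => (n : ℝ)) atTop atTop := tendsto_natCast_atTop_atTop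
  have hsqrt : Tendsto (fun n : ℕ => √(n : ℝ)) atTop atTop := Real.tendsto_sqrt_atTop.comp hnat
  have hlin : ∀ a b : ℝ, 0 < a → ∀ᶠ n : ℕ in atTop, b ≤ a * n := by
    intro a b ha
    filter_upwards [hnat.eventually_ge_atTop (b / a)] with n hn
    rwa [div_le_iff₀' ha] at hn
  have hroot : ∀ a : ℝ, 0 < a → ∀ᶠ n : ℕ in atTop, 12 * √(n : ℝ) ≤ a * n := by
    intro a ha
    filter_upwards [hsqrt.eventually_ge_atTop (12 / a)] with n hn
    rw [div_le_iff₀' ha] at hn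
    have h := Real.mul_self_sqrt (Nat.cast_nonneg (α := ℝ) n)
    nlinarith [Real.sqrt_nonneg (n : ℝ)]
  obtain ⟨N, hN⟩ := eventually_atTop.1 ((hroot ((p - q) / 4) (by linarith)).and
    ((hroot (q / 2) (by linarith)).and
    ((hlin 1 (8 * 12 ^ 2 * (1 / q ^ 2 + 1 / ((p - q) / 2) ^ 2)) one_pos).and
    ((hlin ((p - q) / 4) p (by linarith)).and
    ((hlin (κ / 16) (100 * exceptionBound p q 12 + 1) (by linarith)).and
    (eventually_ge_atTop (2 * M)))))))
  set c := 3 / 16 * κ ^ 2 with hc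
  have hc0 : 0 < c := by positivity
  have hc1 : c ≤ 1 := by rw [hc]; nlinarith
  -- The 3 covers the three exponentials for n ≥ N, since c ≤ 1; the summand e^{cN} makes the bound
  -- at least 1, hence trivial, for n < N.
  refine ⟨κ / 16, by linarith, by linarith, 3 + Real.exp (c * N), c, by positivity, hc0,
    fun n hn2 hn => ?_⟩
  have hexp := Real.exp_pos (-c * (n : ℝ))
  rcases lt_or_ge n N with hlt | hge
  · have := isProbabilityMeasure_sbm n (p := p) (q := q) ⟨by linarith, hp.le⟩
      ⟨hq.le, by linarith⟩
    have h1 : 1 ≤ Real.exp (c * N) * Real.exp (-c * n) := by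
      rw [← Real.exp_add]
      have : (n : ℝ) ≤ N := by exact_mod_cast hlt.le
      exact Real.one_le_exp (by nlinarith)
    have h2 : (sbm n p q).real {G | ¬ ExtremesAttached p q η (κ / 16) G} ≤ 1 := measureReal_le_one
    nlinarith
  · obtain ⟨h1, h2, h3, h4, h5, h6⟩ := hN n hge
    obtain ⟨m, hm⟩ := hn
    have h := measureReal_not_extremesAttached_le (m := m) (by omega) (by omega) hq hqp hp hη.le hκ0
      (hM m (by omega)) h1 h2 (by linarith) h4 h5
    have h7 : Real.exp (-(n : ℝ)) ≤ Real.exp (-c * n) :=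
      Real.exp_le_exp.2 (by nlinarith [Nat.cast_nonneg (α := ℝ) n])
    have h8 : Real.exp (-(3 / 16 * κ ^ 2 * n)) = Real.exp (-c * n) := by rw [hc]; ring_nf
    rw [h8] at h
    nlinarith [Real.exp_pos (c * N)]
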